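/- Let $T=(V,E)$ be a free tree (a finite connected acyclic graph with $n=|V|\ge 1$). A linear arrangement of $T$ is a bijection $\pi$ from $V$ to the $n$ positions $1,\dots,n$; put $D_\pi(T)=\sum_{uv\in E}|\pi(u)-\pi(v)|$ and let $C_\pi(T)$ be the number of pairs of edges that cross in $\pi$, that is, pairs $\{s,t\},\{u,v\}\in E$ with $\pi(s)<\pi(u)<\pi(t)<\pi(v)$. The arrangement is planar if $C_\pi(T)=0$; let $N_{\mathrm{pl}}(T)$ be the number of planar arrangements. Let $\mathbb P$ and $\mathbb E$ refer to an arrangement chosen uniformly at random among all $n!$ arrangements, let $\mathbb E_{\mathrm{pl}}[D(T)]$ be the expectation of $D_\pi(T)$ over a uniformly random planar arrangement, and let $\mathbb E[D(T)\mid C(T)\ge 1]$ be the expectation of $D_\pi(T)$ conditioned on $C_\pi(T)\ge 1$. Then $$\mathbb P(C(T)=0)=\frac{N_{\mathrm{pl}}(T)}{n!},\qquad \mathbb P(C(T)\ge 1)=\frac{n!-N_{\mathrm{pl}}(T)}{n!},$$ and, if some arrangement of $T$ has a crossing (so that the conditional expectation is defined), $\mathbb P(C(T)\ge 1)>0$ and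 $$\mathbb E[D(T)\mid C(T)\ge 1]=\frac{\mathbb E[D(T)]-\mathbb E_{\mathrm{pl}}[D(T)]\,\mathbb P(C(T)=0)}{\mathbb P(C(T)\ge 1)}.$$ Moreover $\mathbb E[D(T)\mid C(T)\ge 1]$ can be computed in time $O(n)$ and space $O(n)$: there are a single program for a random access machine and a constant $K$ such that, for every $n$ and every tree $T$ on $\{0,\dots,n-1\}$, given as $n$ together with a list of its edges in any order and orientation, the program halts after at most $Kn$ steps, using a constant number of variables and of arrays with $Kn$ cells each, and, if some arrangement of $T$ has a crossing, outputs exactly $\mathbb E[D(T)\mid C(T)\ge 1]$. The machine has words, natural numbers below $(n+1)^K$ (with constants, addition, truncated subtraction, comparison, and use as array indices), and exact rational numbers (with conversion from words, the four arithmetic operations and comparison; no rounding and no division by zero); every operation, memory access and test costs one step, and every variable and every array cell, word or rational number, counts as one cell. -/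

import Mathlib

open MeasureTheory ProbabilityTheory
open scoped Nat

noncomputable section

/-! ### Linear arrangements, sums of edge lengths, crossings -/

/-- A linear arrangement of an `n`-element vertex set: a bijection onto the `n` positions
(numbered from `0`; only differences and the order of positions matter). -/
abbrev Arrangement (V : Type*) [Fintype V] : Type _ := V ≃ Fin (Fintype.card V)

/-- Every set of arrangements is an event. -/
instance Arrangement.instMeasurableSpace (V : Type*) [Fintype V] :
    MeasurableSpace (Arrangement V) := ⊤

instance Arrangement.instDiscrete (V : Type*) [Fintype V] :
    DiscreteMeasurableSpace (Arrangement V) := ⟨fun _ => trivial⟩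

/-- The length `|π u - π v|` of the (potential) edge `uv`. -/
def edgeLength {V : Type*} [Fintype V] (π : Arrangement V) : Sym2 V → ℝ :=
  Sym2.lift ⟨fun u v => |((π u : ℕ) : ℝ) - ((π v : ℕ) : ℝ)|, fun _ _ => abs_sub_comm _ _⟩

open scoped Classical in
/-- The sum of the edge lengths of `T` in the arrangement `π`. -/
def sumEdgeLengths {V : Type*} [Fintype V] (T : SimpleGraph V) (π : Arrangement V) : ℝ :=
  ∑ e ∈ T.edgeFinset, edgeLength π e

/-- The number of edge crossings of `T` in `π`. A pair of crossing edges is counted through its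
unique description as `{s,t}`, `{u,v}` with `π s < π u < π t < π v`. -/
def crossings {V : Type*} [Fintype V] (T : SimpleGraph V) (π : Arrangement V) : ℕ :=
  {q : (V × V) × (V × V) | T.Adj q.1.1 q.1.2 ∧ T.Adj q.2.1 q.2.2 ∧
    π q.1.1 < π q.2.1 ∧ π q.2.1 < π q.1.2 ∧ π q.1.2 < π q.2.2}.ncard

/-- The set of planar arrangements, those without crossings. -/
def planarArrangements {V : Type*} [Fintype V] (T : SimpleGraph V) : Set (Arrangement V) :=
  {π | crossings T π = 0}

/-- The number of planar arrangements. -/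
def numPlanar {V : Type*} [Fintype V] (T : SimpleGraph V) : ℕ :=
  (planarArrangements T).ncard

/-- The law of a uniformly random arrangement. -/
def arrangementLaw (V : Type*) [Fintype V] : Measure (Arrangement V) :=
  uniformOn Set.univ

/-- The probability that a uniformly random arrangement has no crossing. -/
def probNoCrossing {V : Type*} [Fintype V] (T : SimpleGraph V) : ℝ :=
  (arrangementLaw V).real {π | crossings T π = 0}

/-- The probability that a uniformly random arrangement has at least one crossing. -/
def probCrossing {V : Type*} [Fintype V] (T : SimpleGraph V) : ℝ :=
  (arrangementLaw V).real {π | 1 ≤ crossings T π}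

/-- The expected sum of edge lengths in a uniformly random arrangement. -/
def expSumLengths {V : Type*} [Fintype V] (T : SimpleGraph V) : ℝ :=
  ∫ π, sumEdgeLengths T π ∂(arrangementLaw V)

/-- The expected sum of edge lengths in a uniformly random planar arrangement. -/
def expSumLengthsPlanar {V : Type*} [Fintype V] (T : SimpleGraph V) : ℝ :=
  ∫ π, sumEdgeLengths T π ∂(uniformOn (planarArrangements T))

/-- The expected sum of edge lengths in a uniformly random arrangement, conditioned on the event
that there is at least one crossing. -/
def expSumLengthsCrossing {V : Type*} [Fintype V] (T : SimpleGraph V) : ℝ :=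
  ∫ π, sumEdgeLengths T π ∂((arrangementLaw V)[|{π | 1 ≤ crossings T π}])

/-! ### A unit-cost random access machine

The machine has word (natural number) variables, arrays of words, variables for exact rational
numbers, and arrays of such numbers. A program names only finitely many variables and arrays.
Arrays have `S` cells, so that a fixed program uses `O(S)` cells of memory altogether, and words
have to stay below `W`. An operation on words or numbers, a memory access and a test cost one
step each. -/

namespace RAM

/-- The contents of the memory. -/
structure State where
  /-- word variables -/
  word : ℕ → ℕ
  /-- arrays of words: `wordArr a i` is the cell `i` of the array `a` -/
  wordArr : ℕ → ℕ → ℕ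
  /-- number variables -/
  num : ℕ → ℚ
  /-- arrays of numbers -/
  numArr : ℕ → ℕ → ℚ

/-- Elementary instructions. The natural numbers `x y z` name variables, `a` names an array. -/
inductive Instr where
  /-- `x := c` for a constant word -/
  | wordConst (x c : ℕ)
  /-- `x := y + z` on words -/
  | wordAdd (x y z : ℕ)
  /-- `x := y - z` on words, truncated at zero -/
  | wordSub (x y z : ℕ)
  /-- `x := a[i]` on words, where `i` is a word variable -/
  | wordLoad (x a i : ℕ)
  /-- `a[i] := x` on words -/
  | wordStore (a i x : ℕ)
  /-- copy the word variable `y` to the number variable `x` -/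
  | numOfWord (x y : ℕ)
  /-- `x := y + z` on numbers -/
  | numAdd (x y z : ℕ)
  /-- `x := y - z` on numbers -/
  | numSub (x y z : ℕ)
  /-- `x := y * z` on numbers -/
  | numMul (x y z : ℕ)
  /-- `x := y / z` on numbers -/
  | numDiv (x y z : ℕ)
  /-- `x := a[i]` on numbers, where `i` is a word variable -/
  | numLoad (x a i : ℕ)
  /-- `a[i] := x` on numbers, where `i` is a word variable -/
  | numStore (a i x : ℕ)

/-- When an instruction can be executed: words stay below `W`, array indices stay below `S`,
and there is no division by zero. -/
def Instr.Legal (S W : ℕ) (σ : State) : Instr → Prop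
  | .wordConst _ c => c < W
  | .wordAdd _ y z => σ.word y + σ.word z < W
  | .wordSub _ _ _ => True
  | .wordLoad _ _ i => σ.word i < S
  | .wordStore _ i _ => σ.word i < S
  | .numOfWord _ _ => True
  | .numAdd _ _ _ => True
  | .numSub _ _ _ => True
  | .numMul _ _ _ => True
  | .numDiv _ _ z => σ.num z ≠ 0
  | .numLoad _ _ i => σ.word i < S
  | .numStore _ i _ => σ.word i < S

/-- The effect of an instruction. -/
def Instr.apply (σ : State) : Instr → State
  | .wordConst x c => { σ with word := Function.update σ.word x c }
  | .wordAdd x y z => { σ with word := Function.update σ.word x (σ.word y + σ.word z) }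
  | .wordSub x y z => { σ with word := Function.update σ.word x (σ.word y - σ.word z) }
  | .wordLoad x a i => { σ with word := Function.update σ.word x (σ.wordArr a (σ.word i)) }
  | .wordStore a i x =>
      let row := Function.update (σ.wordArr a) (σ.word i) (σ.word x)
      { σ with wordArr := Function.update σ.wordArr a row }
  | .numOfWord x y => { σ with num := Function.update σ.num x (σ.word y : ℚ) }
  | .numAdd x y z => { σ with num := Function.update σ.num x (σ.num y + σ.num z) }
  | .numSub x y z => { σ with num := Function.update σ.num x (σ.num y - σ.num z) }
  | .numMul x y z => { σ with num := Function.update σ.num x (σ.num y * σ.num z) }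
  | .numDiv x y z => { σ with num := Function.update σ.num x (σ.num y / σ.num z) }
  | .numLoad x a i => { σ with num := Function.update σ.num x (σ.numArr a (σ.word i)) }
  | .numStore a i x =>
      let row := Function.update (σ.numArr a) (σ.word i) (σ.num x)
      { σ with numArr := Function.update σ.numArr a row }

/-- Tests: comparison of two word variables, or of two number variables. -/
inductive Test where
  | wordLt (x y : ℕ)
  | numLt (x y : ℕ)

/-- When a test succeeds. -/
def Test.Holds (σ : State) : Test → Prop
  | .wordLt x y => σ.word x < σ.word y
  | .numLt x y => σ.num x < σ.num y

/-- Programs. -/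
inductive Prog where
  | skip
  | instr (c : Instr)
  | seq (p q : Prog)
  | ite (b : Test) (p q : Prog)
  | loop (b : Test) (p : Prog)

/-- `Exec S W p σ t σ'`: with arrays of `S` cells and words below `W`, the program `p` started
in `σ` halts after `t` steps in `σ'`, without ever performing an illegal instruction.
Here `loop b p` runs `p` as long as `b` holds. -/
inductive Exec (S W : ℕ) : Prog → State → ℕ → State → Prop where
  | skip (σ : State) : Exec S W .skip σ 0 σ
  | instr (c : Instr) (σ : State) (h : c.Legal S W σ) : Exec S W (.instr c) σ 1 (c.apply σ)
  | seq {p q : Prog} {σ σ' σ'' : State} {t t' : ℕ}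
      (hp : Exec S W p σ t σ') (hq : Exec S W q σ' t' σ'') :
      Exec S W (.seq p q) σ (t + t') σ''
  | ite_true {b : Test} {p q : Prog} {σ σ' : State} {t : ℕ} (h : b.Holds σ)
      (hp : Exec S W p σ t σ') : Exec S W (.ite b p q) σ (t + 1) σ'
  | ite_false {b : Test} {p q : Prog} {σ σ' : State} {t : ℕ} (h : ¬ b.Holds σ)
      (hq : Exec S W q σ t σ') : Exec S W (.ite b p q) σ (t + 1) σ'
  | loop_true {b : Test} {p : Prog} {σ σ' σ'' : State} {t t' : ℕ} (h : b.Holds σ)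
      (hp : Exec S W p σ t σ') (hl : Exec S W (.loop b p) σ' t' σ'') :
      Exec S W (.loop b p) σ (t + t' + 1) σ''
  | loop_false {b : Test} {p : Prog} {σ : State} (h : ¬ b.Holds σ) :
      Exec S W (.loop b p) σ 1 σ

/-- `l` lists every edge of `T` exactly once, in any order and each with either orientation. -/
def IsEdgeList {n : ℕ} (T : SimpleGraph (Fin n)) (l : List (Fin n × Fin n)) : Prop :=
  (l.map fun e => s(e.1, e.2)).Nodup ∧ ∀ e, e ∈ (l.map fun e => s(e.1, e.2)) ↔ e ∈ T.edgeSet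

/-- The memory at the start: the word variable `0` holds the number `n` of vertices, the word
arrays `0` and `1` hold the two end points of the listed edges, all the rest is zero. -/
def input {n : ℕ} (l : List (Fin n × Fin n)) : State where
  word := Function.update (fun _ => 0) 0 n
  wordArr a i :=
    if a = 0 then (l.map fun e => (e.1 : ℕ)).getD i 0
    else if a = 1 then (l.map fun e => (e.2 : ℕ)).getD i 0
    else 0
  num _ := 0
  numArr _ _ := 0

end RAM

end

/-! The formula is the law of total expectation: the arrangements split into planar ones and ones
with a crossing, so the conditional expectation is the difference of the two sums of `D`, over all
and over the planar arrangements, divided by `n! - N_pl` (`expSumLengthsCrossing_eq`). For a tree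
both sums have closed forms that can be evaluated in linear time.

Over all arrangements two distinct vertices are at mean distance `(n + 1) / 3`
(`sum_arrangement_dist`). For planar ones, view an arrangement as a list. Being noncrossing is
invariant under rotation, so any vertex may be put first. If a leaf is hung on `p` and `p` is first,
the branches at `p` occupy intervals, and the leaf fits exactly between them or at an end: `deg p +
1` places, whatever the list (`card_planarLists_fiber`). Hence a uniform planar list restricts, up
to rotation, to a uniform one on any subtree (`Grows.sum_planarLists`), and `N_pl = n ∏ deg!`
(`numPlanar_eq`).

For an edge `uv` with `u` first and `v` at position `k`, the rotations contribute `2 k (n - k)`, and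
`k (n - k) = (n - 1) + (k - 1) (n - 1 - k)`, where the last product counts the pairs `w, w'`
separated by `uv`. In a noncrossing list `w` and `w'` may be replaced by the roots of their branches
at `u` or `v`. What remains is a tree on four vertices, a star or a path, for which exactly one of
its 6 or 4 lists is favourable (`separations_mul`). Summation leaves an expression in degrees and
branch sizes, with one term `planarWeight` per edge.

The program keeps for each vertex its degree, the sum of its remaining neighbours and the number of
vertices already removed behind it. At a leaf the sum of the neighbours is the neighbour, so leaves
can be stripped without adjacency lists; when an edge goes, both its branch sizes are known and its
weight is added. Since only the neighbour of a removed leaf can become a new leaf, one scan with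
such chains removes everything. The factorials are running products. -/

noncomputable section

/-! ### Branches of a tree -/

namespace SimpleGraph

variable {V : Type*} {T : SimpleGraph V}

/-- `T.JoinedIn P a b` says that `a = b`, or `a` and `b` are joined by a walk whose vertices
satisfy `P`. -/
def JoinedIn (T : SimpleGraph V) (P : V → Prop) (a b : V) : Prop :=
  Relation.ReflTransGen (fun x y => T.Adj x y ∧ P x ∧ P y) a b

theorem JoinedIn.symm {P : V → Prop} {a b : V} (h : T.JoinedIn P a b) : T.JoinedIn P b a := by
  induction h with
  | refl => exact .refl
  | tail _ hbc ih => exact .head ⟨hbc.1.symm, hbc.2.2, hbc.2.1⟩ ih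

theorem JoinedIn.trans {P : V → Prop} {a b c : V} (h : T.JoinedIn P a b)
    (h' : T.JoinedIn P b c) : T.JoinedIn P a c :=
  Relation.ReflTransGen.trans h h'

theorem JoinedIn.mono {P Q : V → Prop} {a b : V} (hPQ : ∀ x, P x → Q x)
    (h : T.JoinedIn P a b) : T.JoinedIn Q a b :=
  Relation.ReflTransGen.mono (fun _ _ h => ⟨h.1, hPQ _ h.2.1, hPQ _ h.2.2⟩) _ _ h

theorem JoinedIn.of_adj {P : V → Prop} {a b : V} (h : T.Adj a b) (ha : P a) (hb : P b) :
    T.JoinedIn P a b :=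
  Relation.ReflTransGen.single ⟨h, ha, hb⟩

theorem JoinedIn.right {P : V → Prop} {a b : V} (h : T.JoinedIn P a b) (ha : P a) : P b := by
  rcases Relation.ReflTransGen.cases_tail h with h | ⟨c, -, h⟩
  · exact h ▸ ha
  · exact h.2.2

/-- A walk from `b` to another vertex `p` reaches a neighbour of `p` without meeting `p`. -/
theorem JoinedIn.exists_adj {P : V → Prop} {b p : V} (h : T.JoinedIn P b p) (hb : b ≠ p) :
    ∃ q, T.Adj p q ∧ P q ∧ T.JoinedIn (fun x => P x ∧ x ≠ p) q b := by
  induction h using Relation.ReflTransGen.head_induction_on with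
  | refl => exact absurd rfl hb
  | @head a c hac _ ih =>
    by_cases hc : c = p
    · subst hc
      exact ⟨a, hac.1.symm, hac.2.1, .refl⟩
    · obtain ⟨q, hq, hPq, hqc⟩ := ih hc
      exact ⟨q, hq, hPq, hqc.trans (.of_adj hac.1.symm ⟨hac.2.2, hc⟩ ⟨hac.2.1, hb⟩)⟩

/-- If one end of a walk has a property that the other one does not have, then the property is
lost along an edge of the walk. -/
theorem JoinedIn.exists_adj_not {P Q : V → Prop} {a b : V} (h : T.JoinedIn P a b) (ha : Q a)
    (hb : ¬ Q b) : ∃ x y, T.Adj x y ∧ P x ∧ P y ∧ Q x ∧ ¬ Q y := by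
  induction h using Relation.ReflTransGen.head_induction_on with
  | refl => exact absurd ha hb
  | @head a c hac _ ih =>
    by_cases hc : Q c
    · exact ih hc
    · exact ⟨a, c, hac.1, hac.2.1, hac.2.2, ha, hc⟩

theorem JoinedIn.exists_walk {p a b : V} (h : T.JoinedIn (· ≠ p) a b) (ha : a ≠ p) :
    ∃ w : T.Walk a b, p ∉ w.support := by
  induction h using Relation.ReflTransGen.head_induction_on with
  | refl => exact ⟨.nil, by simpa using ha.symm⟩
  | head hac _ ih =>
    obtain ⟨w, hw⟩ := ih hac.2.2
    exact ⟨.cons hac.1 w, by simp [hw, ha.symm]⟩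

theorem Walk.joinedIn {P : V → Prop} {a b : V} (w : T.Walk a b) (hw : ∀ x ∈ w.support, P x) :
    T.JoinedIn P a b := by
  induction w with
  | nil => exact .refl
  | cons h w ih =>
    refine .head ⟨h, hw _ (by simp), hw _ (by simp)⟩ (ih fun x hx => hw x ?_)
    simp [hx]

/-- Distinct neighbours of a vertex of a forest are separated by it. -/
theorem IsAcyclic.eq_of_joinedIn (hT : T.IsAcyclic) {p q q' : V} (hq : T.Adj p q)
    (hq' : T.Adj p q') (h : T.JoinedIn (· ≠ p) q q') : q = q' := by
  classical
  obtain ⟨w, hw⟩ := h.exists_walk hq.ne'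
  have h1 : (Walk.cons hq (w.toPath : T.Walk q q')).IsPath := by
    rw [Walk.cons_isPath_iff]
    exact ⟨w.toPath.2, fun h => hw (w.support_toPath_subset_support h)⟩
  have h2 : (Walk.cons hq' Walk.nil).IsPath := by
    simp [hq'.ne]
  -- The path through `q` and the single edge both lead from `p` to `q'`, so they coincide; compare
  -- second vertices.
  have := congrArg (fun w : T.Path p q' => w.1.snd) ((hT.subsingleton_path p q').elim ⟨_, h1⟩ ⟨_, h2⟩)
  simpa using this

/-- Since `p` separates its neighbours, a walk from `q` that avoids `p` never meets `q'`. -/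
theorem IsAcyclic.joinedIn_of_ne (hT : T.IsAcyclic) {P : V → Prop} {p q q' x : V}
    (hq : T.Adj p q) (hq' : T.Adj p q') (hne : q ≠ q')
    (h : T.JoinedIn (fun y => P y ∧ y ≠ p) q x) :
    T.JoinedIn (fun y => P y ∧ y ≠ p ∧ y ≠ q') q x := by
  induction h with
  | refl => exact .refl
  | @tail b c hab hbc ih =>
    have key : ∀ y, T.JoinedIn (fun y => P y ∧ y ≠ p) q y → y ≠ q' := by
      rintro y hy rfl
      exact hne (hT.eq_of_joinedIn hq hq' (hy.mono fun _ h => h.2))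
    exact ih.tail ⟨hbc.1, ⟨hbc.2.1.1, hbc.2.1.2, key b hab⟩, hbc.2.2.1, hbc.2.2.2,
      key c (hab.tail hbc)⟩

open scoped Classical in
/-- The neighbour of `p` through which a tree `T` leads from `p` to `x`. -/
def branch (T : SimpleGraph V) (p x : V) : V :=
  if h : ∃ q, T.Adj p q ∧ T.JoinedIn (· ≠ p) q x then h.choose else p

theorem IsAcyclic.branch_eq (hT : T.IsAcyclic) {p q x : V} (hq : T.Adj p q)
    (h : T.JoinedIn (· ≠ p) q x) : T.branch p x = q := by
  have hex : ∃ q, T.Adj p q ∧ T.JoinedIn (· ≠ p) q x := ⟨q, hq, h⟩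
  rw [branch, dif_pos hex]
  exact hT.eq_of_joinedIn hex.choose_spec.1 hq (hex.choose_spec.2.trans h.symm)

theorem IsAcyclic.branch_adj (hT : T.IsAcyclic) {p q : V} (hq : T.Adj p q) : T.branch p q = q :=
  hT.branch_eq hq .refl

theorem Connected.joinedIn (hT : T.Connected) (a b : V) : T.JoinedIn (fun _ => True) a b := by
  obtain ⟨w⟩ := hT.preconnected a b
  exact w.joinedIn fun _ _ => trivial

theorem IsTree.branch_spec (hT : T.IsTree) {p x : V} (hx : x ≠ p) :
    T.Adj p (T.branch p x) ∧ T.JoinedIn (· ≠ p) (T.branch p x) x := by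
  obtain ⟨q, hq, -, hqx⟩ := (hT.1.joinedIn x p).exists_adj hx
  have hqx := hqx.mono (Q := (· ≠ p)) fun _ h => h.2
  rw [hT.2.branch_eq hq hqx]
  exact ⟨hq, hqx⟩

theorem IsTree.branch_eq_branch (hT : T.IsTree) {p x y : V} (hx : x ≠ p)
    (h : T.JoinedIn (· ≠ p) x y) : T.branch p y = T.branch p x :=
  hT.2.branch_eq (hT.branch_spec hx).1 ((hT.branch_spec hx).2.trans h)

/-- The two sides of an edge of a tree. -/
theorem IsTree.branch_iff (hT : T.IsTree) {p q : V} (hpq : T.Adj p q) (x : V) :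
    (x ≠ q ∧ T.branch q x = p) ↔ ¬ (x ≠ p ∧ T.branch p x = q) := by
  constructor
  · rintro ⟨hxq, h1⟩ ⟨hxp, h2⟩
    have hx1 := (hT.branch_spec hxq).2
    have hx2 := (hT.branch_spec hxp).2
    rw [h1] at hx1
    rw [h2] at hx2
    -- The walk from `x` to `p` that avoids `q` enters `p` through a neighbour `r ≠ q`, yet `r` and
    -- `q` are joined through `x` off `p`.
    obtain ⟨r, hr, hrq, hrx⟩ := hx1.symm.exists_adj hxp
    exact hrq (hT.2.eq_of_joinedIn hr hpq ((hrx.mono fun _ h => h.2).trans hx2.symm))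
  · intro h
    by_cases hxp : x = p
    · subst hxp
      exact ⟨hpq.ne, hT.2.branch_adj hpq.symm⟩
    · have hne : T.branch p x ≠ q := fun h' => h ⟨hxp, h'⟩
      obtain ⟨hb, hbx⟩ := hT.branch_spec hxp
      have h3 := hT.2.joinedIn_of_ne (P := fun _ => True) hb hpq hne
        (hbx.mono fun _ h => ⟨trivial, h⟩)
      have h4 : T.JoinedIn (· ≠ q) p x :=
        JoinedIn.trans (.of_adj hb hpq.ne hne) (h3.mono fun _ h => h.2.2)
      exact ⟨h4.right hpq.ne, hT.2.branch_eq hpq.symm h4⟩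

variable [Fintype V] [DecidableEq V]

/-- The number of vertices that a tree has on the side of `q` of an edge `pq`. -/
def branchSize (T : SimpleGraph V) (p q : V) : ℕ :=
  (Finset.univ.filter fun x => x ≠ p ∧ T.branch p x = q).card

theorem IsTree.branchSize_add (hT : T.IsTree) {p q : V} (hpq : T.Adj p q) :
    T.branchSize p q + T.branchSize q p = Fintype.card V := by
  rw [branchSize, branchSize, Finset.filter_congr fun x _ => hT.branch_iff hpq x,
    Finset.card_filter_add_card_filter_not]
  rfl

theorem IsTree.sum_branchSize [DecidableRel T.Adj] (hT : T.IsTree) (p : V) :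
    ∑ q ∈ T.neighborFinset p, T.branchSize p q + 1 = Fintype.card V := by
  have h : (Finset.univ.erase p).card = ∑ q ∈ T.neighborFinset p,
      ((Finset.univ.erase p).filter fun x => T.branch p x = q).card := by
    refine Finset.card_eq_sum_card_fiberwise fun x hx => ?_
    simpa using (hT.branch_spec (by simpa using hx)).1
  rw [← Finset.card_univ, ← Finset.card_erase_add_one (Finset.mem_univ p), h]
  congr 1
  refine Finset.sum_congr rfl fun q _ => ?_
  rw [branchSize]
  congr 1
  ext x
  simp

end SimpleGraph

/-! ### Noncrossing lists -/

section Noncrossing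

variable {V : Type*} {T : SimpleGraph V}

/-- No two edges of `T` cross when the vertices are written in the order of `l`. -/
def Noncrossing (T : SimpleGraph V) (l : List V) : Prop :=
  ∀ s u t v, T.Adj s t → T.Adj u v → ¬ [s, u, t, v].Sublist l

theorem Noncrossing.sublist {l l' : List V} (h : Noncrossing T l) (hl : l'.Sublist l) :
    Noncrossing T l' :=
  fun s u t v hst huv h' => h s u t v hst huv (h'.trans hl)

/-- If the moved vertex is the last one, `v`, of a crossing `s, u, t, v`, then the old order is `v,
s, u, t`, a crossing with the two edges exchanged. -/
theorem Noncrossing.append_singleton {a : V} {l : List V} (h : Noncrossing T (a :: l)) :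
    Noncrossing T (l ++ [a]) := by
  intro s u t v hst huv hsub
  obtain ⟨l₁, l₂, heq, h₁, h₂⟩ := List.sublist_append_iff.1 hsub
  rcases List.sublist_singleton.1 h₂ with rfl | rfl
  · rw [List.append_nil] at heq
    subst heq
    exact h s u t v hst huv (h₁.cons a)
  · have : [s, u, t] ++ [v] = l₁ ++ [a] := heq
    obtain ⟨rfl, hva⟩ := List.append_inj' this rfl
    obtain rfl : v = a := by simpa using hva
    exact h v s u t huv.symm hst (h₁.cons_cons v)

theorem Noncrossing.isRotated {l l' : List V} (h : Noncrossing T l) (hl : l ~r l') :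
    Noncrossing T l' := by
  obtain ⟨k, rfl⟩ := hl
  induction k generalizing l with
  | zero => simpa using h
  | succ k ih =>
    cases l with
    | nil => simpa using h
    | cons a l =>
      rw [List.rotate_cons_succ]
      exact ih h.append_singleton

/-- As `r` occurs only once, only the trivial rotation keeps it in front. Fixing the first vertex
thus selects one list from each rotation class. -/
theorem List.IsRotated.eq_of_cons {r : V} {m m' : List V} (h : (r :: m) ~r (r :: m'))
    (hn : (r :: m).Nodup) : m = m' := by
  obtain ⟨k, hk, h⟩ := List.isRotated_iff_mod.1 h
  rw [List.rotate_eq_drop_append_take hk] at h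
  rcases k with _ | k
  · simpa using h
  · rw [List.drop_succ_cons, List.take_succ_cons] at h
    rcases hd : m.drop k with _ | ⟨x, y⟩
    · rw [hd] at h
      have h1 : m.take k = m := by
        rw [List.take_eq_self_iff]
        simpa using hd
      simpa [h1] using h
    · rw [hd] at h
      have hx : x = r := by simpa using congrArg List.head? h
      have : x ∈ m.drop k := by simp [hd]
      exact absurd (hx ▸ List.mem_of_mem_drop this) (List.nodup_cons.1 hn).1

variable [DecidableEq V]

/-- The number of ways to cut a list between the classes of a labelling with contiguous
classes. -/
theorem List.card_cuts {W : Type*} [DecidableEq W] (f : V → W) (m : List V)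
    (hm : ∀ a b c, [a, b, c].Sublist m → f a = f c → f b = f a) :
    ((Finset.range (m.length + 1)).filter fun k =>
      ∀ a ∈ m.take k, ∀ b ∈ m.drop k, f a ≠ f b).card = (m.toFinset.image f).card + 1 := by
  induction m with
  | nil => simp
  | cons a m ih =>
    have ih := ih fun x y z h => hm x y z (h.cons a)
    rw [Finset.card_filter, List.length_cons, Finset.sum_range_succ']
    simp only [List.take_zero, List.not_mem_nil, false_implies, implies_true, if_true,
      List.take_succ_cons, List.drop_succ_cons, List.mem_cons, forall_eq_or_imp]
    congr 1
    -- If the class of `a` occurs again, contiguity puts the head of `m` into it: the cut right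
    -- after `a` is lost, and the later cuts are those of `m`. Otherwise every cut of `m` survives
    -- and the one before `a` is new.
    by_cases ha : f a ∈ m.toFinset.image f
    · rw [List.toFinset_cons, Finset.image_insert, Finset.insert_eq_of_mem ha]
      apply Nat.add_right_cancel (m := 1)
      rw [← ih, Finset.card_filter, Finset.sum_range_succ', Finset.sum_range_succ']
      obtain ⟨c, hc, hca⟩ := Finset.mem_image.1 ha
      rw [List.mem_toFinset] at hc
      rw [if_neg (by
        rintro ⟨h, -⟩
        exact h c (by simpa using hc) hca.symm), add_zero, if_pos (by simp)]
      congr 1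
      refine Finset.sum_congr rfl fun k _ => ?_
      congr 1
      rw [eq_iff_iff, and_iff_right_iff_imp]
      rcases m with _ | ⟨b, m⟩
      · simp
      · have hb : f b = f a := by
          rcases List.mem_cons.1 hc with rfl | hc
          · exact hca
          · exact hm a b c (((List.singleton_sublist.2 hc).cons_cons b).cons_cons a) hca.symm
        intro h x hx
        rw [← hb]
        exact h b (by simp) x hx
    · rw [List.toFinset_cons, Finset.image_insert, Finset.card_insert_of_notMem ha, ← ih,
        Finset.card_filter]
      refine Finset.sum_congr rfl fun k _ => ?_
      congr 1
      rw [eq_iff_iff, and_iff_right_iff_imp]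
      intro _ x hx hax
      exact ha (Finset.mem_image.2 ⟨x, by simpa using List.mem_of_mem_drop hx, hax.symm⟩)

open scoped Classical in
/-- The noncrossing lists that enumerate `S` and start with `r`. -/
def planarLists (T : SimpleGraph V) (S : Finset V) (r : V) : Finset (List V) :=
  S.toList.permutations.toFinset.filter fun l => Noncrossing T l ∧ l.head? = some r

theorem mem_planarLists {S : Finset V} {r : V} {l : List V} :
    l ∈ planarLists T S r ↔
      l.Nodup ∧ (∀ x, x ∈ l ↔ x ∈ S) ∧ Noncrossing T l ∧ l.head? = some r := by
  simp only [planarLists, Finset.mem_filter, List.mem_toFinset, List.mem_permutations]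
  rw [← and_assoc (a := l.Nodup)]
  refine and_congr ⟨fun h => And.intro (h.nodup_iff.2 S.nodup_toList) fun x => ?_, fun h => ?_⟩
    Iff.rfl
  · rw [h.mem_iff, Finset.mem_toList]
  · exact (List.perm_ext_iff_of_nodup h.1 S.nodup_toList).2 fun x => by
      rw [h.2, Finset.mem_toList]

/-- The number of arrangements with a given first vertex, and other statistics that are invariant
under rotation, do not depend on the first vertex. -/
theorem sum_planarLists_root {S : Finset V} {r r' : V} (hr : r ∈ S) (hr' : r' ∈ S)
    (g : List V → ℕ) (hg : ∀ l l', l ~r l' → g l = g l') :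
    ∑ l ∈ planarLists T S r, g l = ∑ l ∈ planarLists T S r', g l := by
  have key : ∀ s ∈ S, ∀ l : List V, (∀ x, x ∈ l ↔ x ∈ S) →
      (l.rotate (l.idxOf s)).head? = some s := by
    intro s hs l hl
    have h : l.idxOf s < l.length := List.idxOf_lt_length_iff.2 ((hl s).2 hs)
    rw [List.head?_rotate h, List.getElem?_eq_getElem h, List.getElem_idxOf]
  have mem : ∀ s s', s' ∈ S → ∀ l ∈ planarLists T S s,
      l.rotate (l.idxOf s') ∈ planarLists T S s' := by
    intro s s' hs l hl
    rw [mem_planarLists] at hl ⊢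
    exact ⟨List.nodup_rotate.2 hl.1, fun x => by rw [List.mem_rotate, hl.2.1],
      hl.2.2.1.isRotated ⟨_, rfl⟩, key s' hs l hl.2.1⟩
  have eq : ∀ s, ∀ l ∈ planarLists T S s, ∀ l' ∈ planarLists T S s, l ~r l' → l = l' := by
    intro s l hl l' hl' h
    rw [mem_planarLists] at hl hl'
    obtain ⟨m, rfl⟩ := List.head?_eq_some_iff.1 hl.2.2.2
    obtain ⟨m', rfl⟩ := List.head?_eq_some_iff.1 hl'.2.2.2
    rw [h.eq_of_cons hl.1]
  refine Finset.sum_bij (fun l _ => l.rotate (l.idxOf r')) (mem r r' hr') ?_ ?_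
    (fun l _ => hg _ _ ⟨_, rfl⟩)
  · intro l hl l' hl' h
    refine eq r l hl l' hl' ?_
    exact List.IsRotated.trans (l' := l.rotate (l.idxOf r')) ⟨_, rfl⟩ (h ▸ List.IsRotated.symm ⟨_, rfl⟩)
  · intro l hl
    refine ⟨_, mem r' r hr l hl, ?_⟩
    refine eq r' _ (mem r r' hr' _ (mem r' r hr l hl)) _ hl ?_
    exact (List.IsRotated.trans ⟨_, rfl⟩ ⟨_, rfl⟩ : l ~r _).symm

end Noncrossing

/-! ### Restricting noncrossing lists to a subtree -/

section Growth

variable {V : Type*} {T : SimpleGraph V}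

/-- Any two vertices in `S` are joined by a walk in `S`. -/
def ConnectedSet (T : SimpleGraph V) (S : Finset V) : Prop :=
  ∀ a ∈ S, ∀ b ∈ S, T.JoinedIn (· ∈ S) a b

/-- Every vertex of the walk is reached from `a` by an initial piece of it. -/
theorem SimpleGraph.JoinedIn.self {P : V → Prop} {a b : V} (h : T.JoinedIn P a b) :
    T.JoinedIn (fun x => P x ∧ T.JoinedIn P a x) a b := by
  induction h with
  | refl => exact .refl
  | tail hab hbc ih =>
    exact ih.tail ⟨hbc.1, ⟨hbc.2.1, hab⟩, hbc.2.2, hab.tail hbc⟩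

theorem ConnectedSet.branch_mem (hT : T.IsTree) {S : Finset V} (hS : ConnectedSet T S) {p x : V}
    (hp : p ∈ S) (hx : x ∈ S) (hxp : x ≠ p) : T.branch p x ∈ S ∧
      T.JoinedIn (fun y => y ∈ S ∧ y ≠ p ∧ T.branch p y = T.branch p x) (T.branch p x) x := by
  obtain ⟨q, hq, hqS, hqx⟩ := (hS x hx p hp).exists_adj hxp
  have hbr : ∀ y, T.JoinedIn (fun y => y ∈ S ∧ y ≠ p) q y → T.branch p y = q := fun y hy =>
    hT.2.branch_eq hq (hy.mono fun _ h => h.2)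
  rw [hbr x hqx]
  exact ⟨hqS, hqx.self.mono fun y hy => ⟨hy.1.1, hy.1.2, hbr y hy.2⟩⟩

/-- With positions increasing along `l`, containing a pattern amounts to inequalities between
positions, which `omega` can handle. -/
theorem List.sublist_iff_pairwise {pos : V → ℕ} {l : List V}
    (hl : l.Pairwise fun a b => pos a < pos b) (L : List V) :
    L.Sublist l ↔ (∀ x ∈ L, x ∈ l) ∧ L.Pairwise fun a b => pos a < pos b := by
  refine ⟨fun h => ⟨fun x hx => h.subset hx, hl.sublist h⟩, fun ⟨h, hL⟩ => ?_⟩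
  have : Std.Antisymm fun a b : V => pos a < pos b :=
    ⟨fun a b h h' => absurd h (lt_asymm h')⟩
  refine List.sublist_of_subperm_of_pairwise (List.subperm_of_subset ?_ h) hL hl
  exact hL.imp fun h => fun h' => lt_irrefl _ (h' ▸ h)

theorem List.Nodup.pairwise_idxOf [DecidableEq V] {l : List V} (hl : l.Nodup) :
    l.Pairwise fun a b => l.idxOf a < l.idxOf b := by
  rw [List.pairwise_iff_getElem]
  intro i j hi hj hij
  rwa [hl.idxOf_getElem, hl.idxOf_getElem]

theorem Noncrossing.not_lt {pos : V → ℕ} {l : List V} (h : Noncrossing T l)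
    (hl : l.Pairwise fun a b => pos a < pos b) {s u t v : V} (hs : s ∈ l) (hu : u ∈ l)
    (ht : t ∈ l) (hv : v ∈ l) (hst : T.Adj s t) (huv : T.Adj u v) (h1 : pos s < pos u)
    (h2 : pos u < pos t) : ¬ pos t < pos v := by
  intro h3
  refine h s u t v hst huv ((List.sublist_iff_pairwise hl _).2 ⟨by simp [*], ?_⟩)
  simp
  omega

variable [DecidableEq V]

/-- In a noncrossing list, vertices that are joined by a walk avoiding both ends of an edge lie on
the same side of that edge. -/
theorem Noncrossing.between_of_joinedIn {l : List V} (hl : Noncrossing T l) (hn : l.Nodup)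
    {s t a b : V} (hst : T.Adj s t) (hs : s ∈ l) (ht : t ∈ l)
    (hab : T.JoinedIn (fun x => x ∈ l ∧ x ≠ s ∧ x ≠ t) a b)
    (ha : l.idxOf s < l.idxOf a ∧ l.idxOf a < l.idxOf t) :
    l.idxOf s < l.idxOf b ∧ l.idxOf b < l.idxOf t := by
  by_contra hb
  obtain ⟨x, y, hxy, ⟨hx, hxs, hxt⟩, ⟨hy, hys, hyt⟩, hQx, hQy⟩ := hab.exists_adj_not
    (Q := fun x => l.idxOf s < l.idxOf x ∧ l.idxOf x < l.idxOf t) ha hb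
  have hys : l.idxOf y ≠ l.idxOf s := fun h => hys ((List.idxOf_inj hy).1 h)
  have hyt : l.idxOf y ≠ l.idxOf t := fun h => hyt ((List.idxOf_inj hy).1 h)
  -- The edge `xy` leaves the interval between `s` and `t`, so it crosses `st`, whether `y` lies
  -- before `s` or after `t`.
  have h1 := hl.not_lt hn.pairwise_idxOf hy hs hx ht hxy.symm hst
  have h2 := hl.not_lt hn.pairwise_idxOf hs hx ht hy hst hxy
  omega

/-- The subtrees hanging from the first vertex occupy intervals. -/
theorem Noncrossing.branch_contiguous (hT : T.IsTree) {S : Finset V} (hS : ConnectedSet T S)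
    {p : V} {m : List V} (hn : (p :: m).Nodup) (hm : ∀ x, x ∈ p :: m ↔ x ∈ S)
    (hl : Noncrossing T (p :: m)) {a b c : V} (habc : [a, b, c].Sublist m)
    (hac : T.branch p a = T.branch p c) : T.branch p b = T.branch p a := by
  by_contra hne
  obtain ⟨hmem, hpos⟩ := (List.sublist_iff_pairwise hn.pairwise_idxOf _).1 (habc.cons_cons p)
  have hp := hmem p (by simp)
  have ha := hmem a (by simp)
  have hb := hmem b (by simp)
  have hc := hmem c (by simp)
  simp only [List.pairwise_cons, List.mem_cons, List.not_mem_nil, or_false, forall_eq_or_imp,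
    forall_eq] at hpos
  set l := p :: m with hldef
  have hne' : ∀ x, l.idxOf p < l.idxOf x → x ≠ p := fun x hx h => lt_irrefl _ (h ▸ hx)
  have hja := hS.branch_mem hT ((hm p).1 hp) ((hm a).1 ha) (hne' a (by omega))
  have hjb := hS.branch_mem hT ((hm p).1 hp) ((hm b).1 hb) (hne' b (by omega))
  have hjc := hS.branch_mem hT ((hm p).1 hp) ((hm c).1 hc) (hne' c (by omega))
  rw [← hac] at hjc
  -- The walk from `a` to `c` inside their branch jumps over `b` along an edge `st`. The branch of
  -- `b` avoids `s` and `t`, so all of it, including its root, lies between them.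
  obtain ⟨s, t, hst, ⟨hs, hsp, hsa⟩, ⟨ht, htp, hta⟩, hsb, htb⟩ :=
    (hja.2.symm.trans hjc.2).exists_adj_not (Q := fun x => l.idxOf x < l.idxOf b)
      (by omega) (by omega)
  have htb' : l.idxOf b ≠ l.idxOf t := fun h => hne (by rw [(List.idxOf_inj hb).1 h, hta])
  have hbr := hl.between_of_joinedIn hn hst ((hm s).2 hs) ((hm t).2 ht)
    (hjb.2.symm.mono fun x hx => ⟨(hm x).2 hx.1, fun h => hne (by rw [← hx.2.2, h, hsa]),
      fun h => hne (by rw [← hx.2.2, h, hta])⟩) (by omega)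
  have hps : l.idxOf p < l.idxOf s := by
    have : l.idxOf p = 0 := by simp [hldef]
    have : l.idxOf p ≠ l.idxOf s := fun h => hsp ((List.idxOf_inj hp).1 h).symm
    omega
  -- The root of the branch of `b` is adjacent to `p`, which lies before `s`; this edge crosses
  -- `st`.
  exact hl.not_lt hn.pairwise_idxOf hp ((hm s).2 hs) ((hm _).2 hjb.1) ((hm t).2 ht)
    (hT.branch_spec (hne' b (by omega))).1 hst hps hbr.1 hbr.2

end Growth

/-! ### Inserting a leaf into a noncrossing list -/

section Fibers

variable {V : Type*} {T : SimpleGraph V}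

/-- Two neighbours of `a` in the connected set `S` would close a cycle through `a`. -/
theorem ConnectedSet.eq_of_adj (hT : T.IsTree) {S : Finset V} (hS : ConnectedSet T S) {p q a : V}
    (hp : p ∈ S) (hq : q ∈ S) (ha : a ∉ S) (hpa : T.Adj p a) (hqa : T.Adj q a) : q = p :=
  hT.2.eq_of_joinedIn hqa.symm hpa.symm
    ((hS q hq p hp).mono fun _ hx h => ha (h ▸ hx))

variable [DecidableEq V]

theorem ConnectedSet.insert_of_adj {S : Finset V} (hS : ConnectedSet T S) {p a : V}
    (hp : p ∈ S) (hpa : T.Adj p a) : ConnectedSet T (insert a S) := by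
  have h : ∀ x ∈ insert a S, T.JoinedIn (· ∈ insert a S) x p := by
    intro x hx
    rcases Finset.mem_insert.1 hx with rfl | hx
    · exact .of_adj hpa.symm (by simp) (by simp [hp])
    · exact (hS x hx p hp).mono fun _ h => Finset.mem_insert_of_mem h
  exact fun x hx y hy => (h x hx).trans (h y hy).symm

theorem List.filter_ne_of_notMem {a : V} {l : List V} (h : a ∉ l) : l.filter (· ≠ a) = l := by
  rw [List.filter_eq_self]
  rintro b hb
  rw [decide_eq_true_iff]
  rintro rfl
  exact h hb

/-- Where a leaf can be inserted into a noncrossing list that starts with its neighbour. -/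
theorem noncrossing_insert_iff (hT : T.IsTree) {S : Finset V} (hS : ConnectedSet T S)
    {p a : V} (hp : p ∈ S) (ha : a ∉ S) (hpa : T.Adj p a) {x y : List V}
    (hn : (p :: (x ++ y)).Nodup) (hm : ∀ z, z ∈ p :: (x ++ y) ↔ z ∈ S)
    (hl : Noncrossing T (p :: (x ++ y))) :
    Noncrossing T (p :: (x ++ a :: y)) ↔ ∀ b ∈ x, ∀ c ∈ y, T.branch p b ≠ T.branch p c := by
  have hxS : ∀ b ∈ x, b ∈ S := fun b hb => (hm b).1 (by simp [hb])
  have hyS : ∀ b ∈ y, b ∈ S := fun b hb => (hm b).1 (by simp [hb])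
  have hxp : ∀ b ∈ x, b ≠ p := by
    rintro b hb rfl
    exact (List.nodup_cons.1 hn).1 (by simp [hb])
  have hyp : ∀ b ∈ y, b ≠ p := by
    rintro b hb rfl
    exact (List.nodup_cons.1 hn).1 (by simp [hb])
  constructor
  · intro h b hb c hc hbc
    have hjb := (hS.branch_mem hT hp (hxS b hb) (hxp b hb)).2
    have hjc := (hS.branch_mem hT hp (hyS c hc) (hyp c hc)).2
    rw [← hbc] at hjc
    have hcx : c ∉ x := fun h =>
      (List.nodup_append.1 (List.nodup_cons.1 hn).2).2.2 c h c hc rfl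
    -- A branch that meets both `x` and `y` has an edge passing over `a`, and this edge crosses
    -- `pa`.
    obtain ⟨s, t, hst, -, ⟨ht, htp, -⟩, hsx, htx⟩ :=
      (hjb.symm.trans hjc).exists_adj_not (Q := (· ∈ x)) hb hcx
    have hty : t ∈ y := by
      have := (hm t).2 ht
      simp only [List.mem_cons, List.mem_append] at this
      tauto
    refine h p s a t hpa hst ?_
    exact ((List.singleton_sublist.2 hsx).append
      ((List.singleton_sublist.2 hty).cons_cons a)).cons_cons p
  · intro h s u t v hst huv hsub
    have hnl : (p :: (x ++ a :: y)).Nodup := by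
      have : (a :: (p :: (x ++ y))).Nodup :=
        List.nodup_cons.2 ⟨fun h => ha ((hm a).1 h), hn⟩
      refine (List.Perm.nodup_iff ?_).2 this
      exact (List.Perm.cons p List.perm_middle).trans (List.Perm.swap _ _ _)
    have hmem : ∀ z ∈ p :: (x ++ a :: y), z ≠ a → z ∈ S := by
      intro z hz hza
      refine (hm z).1 ?_
      simp only [List.mem_cons, List.mem_append] at hz ⊢
      tauto
    obtain ⟨hsub', hpos⟩ := (List.sublist_iff_pairwise hnl.pairwise_idxOf _).1 hsub
    have hp0 : List.idxOf p (p :: (x ++ a :: y)) = 0 := by simp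
    have hs := hsub' s (by simp)
    have hu := hsub' u (by simp)
    have ht := hsub' t (by simp)
    have hv := hsub' v (by simp)
    simp only [List.pairwise_cons, List.mem_cons, List.not_mem_nil, or_false, forall_eq_or_imp,
      forall_eq] at hpos
    -- The only edge at `a` leads to `p`, which stands first. So a crossing that involves `a` has `s
    -- = p` and `t = a`; the other three positions of `a` would put a vertex before `p`.
    have key : ∀ q, q ∈ p :: (x ++ a :: y) → T.Adj q a → q = p := fun q hq hqa =>
      hS.eq_of_adj hT hp (hmem q hq hqa.ne) ha hpa hqa
    by_cases hsa : s = a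
    · subst hsa
      rw [key t ht hst.symm] at hpos
      omega
    by_cases hua : u = a
    · subst hua
      rw [key v hv huv.symm] at hpos
      omega
    by_cases hva : v = a
    · subst hva
      rw [key u hu huv] at hpos
      omega
    -- In this case `u ∈ x` and `v ∈ y` are adjacent and different from `p`, hence in the same
    -- branch at `p`.
    by_cases hta : t = a
    · subst hta
      obtain rfl := key s hs hst
      have hsub2 := List.cons_sublist_cons.1 hsub
      have htx : t ∉ x := fun h => ha (hxS t h)
      have hty : t ∉ y := fun h => ha (hyS t h)
      have hup : u ≠ s := by
        rintro rfl
        omega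
      have hvp : v ≠ s := by
        rintro rfl
        omega
      have hux : u ∈ x := by
        by_contra hux
        have h1 : List.idxOf u (s :: (x ++ t :: y)) = _ := List.idxOf_cons_ne _ hup.symm
        have h2 : List.idxOf t (s :: (x ++ t :: y)) = _ := List.idxOf_cons_ne _ hst.ne
        rw [List.idxOf_append_of_notMem hux] at h1
        rw [List.idxOf_append_of_notMem htx, List.idxOf_cons_self] at h2
        omega
      have hvy : v ∈ y := by
        have hvx : v ∉ x := by
          intro hvx
          have h1 : List.idxOf v (s :: (x ++ t :: y)) = _ := List.idxOf_cons_ne _ hvp.symm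
          have h2 : List.idxOf t (s :: (x ++ t :: y)) = _ := List.idxOf_cons_ne _ hst.ne
          rw [List.idxOf_append_of_mem hvx] at h1
          rw [List.idxOf_append_of_notMem htx, List.idxOf_cons_self] at h2
          have := List.idxOf_lt_length_iff.2 hvx
          omega
        simp only [List.mem_cons, List.mem_append] at hv
        tauto
      exact h u hux v hvy (hT.branch_eq_branch hup (.of_adj huv hup hvp)).symm
    -- A crossing without `a` persists when `a` is deleted from the list.
    · refine hl s u t v hst huv ?_
      have hax : a ∉ x := fun h => ha (hxS a h)
      have hay : a ∉ y := fun h => ha (hyS a h)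
      have := hsub.filter (fun z => decide (z ≠ a))
      rwa [List.filter_eq_self.2 (by simp [*]), List.filter_cons_of_pos (by simpa using hpa.ne),
        List.filter_append, List.filter_cons_of_neg (by simp), List.filter_ne_of_notMem hax,
        List.filter_ne_of_notMem hay] at this

variable [DecidableRel T.Adj]

/-- The number of neighbours of `x` in `S`. -/
def degreeIn (T : SimpleGraph V) [DecidableRel T.Adj] (S : Finset V) (x : V) : ℕ :=
  (S.filter (T.Adj x)).card

/-- The branches at `p` occupy intervals of the rest of `m`, one for each neighbour of `p` in `S`;
the leaf may go between two consecutive ones or at either end. That the count does not depend on `m`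
is what makes restriction to a subtree uniform. -/
theorem card_planarLists_fiber (hT : T.IsTree) {S : Finset V} (hS : ConnectedSet T S)
    {p a : V} (hp : p ∈ S) (ha : a ∉ S) (hpa : T.Adj p a) {m : List V}
    (hm : m ∈ planarLists T S p) :
    ((planarLists T (insert a S) p).filter fun l => l.filter (· ≠ a) = m).card =
      degreeIn T S p + 1 := by
  rw [mem_planarLists] at hm
  obtain ⟨hn, hmS, hl, hhd⟩ := hm
  obtain ⟨m, rfl⟩ := List.head?_eq_some_iff.1 hhd
  have himg : m.toFinset.image (T.branch p) = S.filter (T.Adj p) := by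
    ext q
    simp only [Finset.mem_image, List.mem_toFinset, Finset.mem_filter]
    constructor
    · rintro ⟨x, hx, rfl⟩
      have hxp : x ≠ p := by
        rintro rfl
        exact (List.nodup_cons.1 hn).1 hx
      exact ⟨(hS.branch_mem hT hp ((hmS x).1 (by simp [hx])) hxp).1, (hT.branch_spec hxp).1⟩
    · rintro ⟨hq, hpq⟩
      refine ⟨q, ?_, hT.2.branch_adj hpq⟩
      exact (List.mem_cons.1 ((hmS q).2 hq)).resolve_left hpq.ne'
  rw [degreeIn, ← himg, ← List.card_cuts (T.branch p) m
    fun b c d hsub hbd => hl.branch_contiguous hT hS hn hmS hsub hbd]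
  have ham : a ∉ m := fun h => ha ((hmS a).1 (by simp [h]))
  have hiff : ∀ k, Noncrossing T (p :: (m.take k ++ a :: m.drop k)) ↔
      ∀ b ∈ m.take k, ∀ c ∈ m.drop k, T.branch p b ≠ T.branch p c := fun k =>
    noncrossing_insert_iff hT hS hp ha hpa (by rwa [List.take_append_drop])
      (by rwa [List.take_append_drop]) (by rwa [List.take_append_drop])
  symm
  refine Finset.card_bij (fun k _ => p :: (m.take k ++ a :: m.drop k)) ?_ ?_ ?_
  · intro k hk
    rw [Finset.mem_filter] at hk
    have hperm : (p :: (m.take k ++ a :: m.drop k)).Perm (a :: p :: m) := by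
      have := List.perm_middle (a := a) (l₁ := m.take k) (l₂ := m.drop k)
      rw [List.take_append_drop] at this
      exact (this.cons p).trans (.swap _ _ _)
    rw [Finset.mem_filter, mem_planarLists]
    refine ⟨⟨hperm.nodup_iff.2 (List.nodup_cons.2 ⟨fun h => ha ((hmS a).1 h), hn⟩), fun z => ?_,
      (hiff k).2 hk.2, rfl⟩, ?_⟩
    · rw [hperm.mem_iff, List.mem_cons, hmS, Finset.mem_insert]
    · rw [List.filter_cons_of_pos (by simpa using hpa.ne), List.filter_append,
        List.filter_cons_of_neg (by simp), List.filter_ne_of_notMem fun h => ham (List.mem_of_mem_take h),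
        List.filter_ne_of_notMem fun h => ham (List.mem_of_mem_drop h), List.take_append_drop]
  · intro k hk k' hk' h
    rw [Finset.mem_filter, Finset.mem_range] at hk hk'
    have h := congrArg (List.idxOf a) (List.cons.inj h).2
    rw [List.idxOf_append_of_notMem fun h => ham (List.mem_of_mem_take h),
      List.idxOf_append_of_notMem fun h => ham (List.mem_of_mem_take h), List.idxOf_cons_self,
      List.idxOf_cons_self, List.length_take, List.length_take] at h
    omega
  · intro l hl'
    rw [Finset.mem_filter, mem_planarLists] at hl'
    obtain ⟨⟨hln, hlS, hlc, hlh⟩, hlf⟩ := hl'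
    obtain ⟨l, rfl⟩ := List.head?_eq_some_iff.1 hlh
    have hal : a ∈ l := (List.mem_cons.1 ((hlS a).2 (by simp))).resolve_left hpa.ne'
    obtain ⟨x, y, rfl⟩ := List.append_of_mem hal
    have hn' := List.nodup_middle.1 (List.nodup_cons.1 hln).2
    have hax : a ∉ x := fun h => (List.nodup_cons.1 hn').1 (by simp [h])
    have hay : a ∉ y := fun h => (List.nodup_cons.1 hn').1 (by simp [h])
    rw [List.filter_cons_of_pos (by simpa using hpa.ne), List.filter_append,
        List.filter_cons_of_neg (by simp), List.filter_ne_of_notMem hax, List.filter_ne_of_notMem hay] at hlf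
    obtain rfl := (List.cons.inj hlf).2
    have ht : (x ++ y).take x.length = x := List.take_left
    have hd : (x ++ y).drop x.length = y := List.drop_left
    refine ⟨x.length, ?_, by rw [ht, hd]⟩
    rw [Finset.mem_filter]
    refine ⟨by simp, (hiff _).1 ?_⟩
    rw [ht, hd]
    exact hlc

end Fibers

/-! ### Degrees within a vertex set -/

section Degrees

variable {V : Type*} {T : SimpleGraph V}

theorem connectedSet_singleton (r : V) : ConnectedSet T {r} := by
  intro a ha b hb
  obtain rfl := Finset.mem_singleton.1 ha
  obtain rfl := Finset.mem_singleton.1 hb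
  exact .refl

variable [DecidableRel T.Adj]

theorem degreeIn_univ [Fintype V] (x : V) : degreeIn T Finset.univ x = T.degree x := by
  rw [degreeIn, ← SimpleGraph.card_neighborFinset_eq_degree, SimpleGraph.neighborFinset_eq_filter]

theorem degreeIn_insert [DecidableEq V] {S : Finset V} {a : V} (ha : a ∉ S) (x : V) :
    degreeIn T (insert a S) x = degreeIn T S x + if T.Adj x a then 1 else 0 := by
  rw [degreeIn, Finset.filter_insert, degreeIn]
  split_ifs
  · rw [Finset.card_insert_of_notMem (by simp [ha])]
  · rfl

theorem degreeIn_singleton (r : V) : degreeIn T {r} r = 0 := by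
  rw [degreeIn, Finset.card_eq_zero]
  simp [Finset.filter_singleton]

end Degrees

/-! ### Growing a subtree and counting planar lists -/

section Growth

variable {V : Type*} [DecidableEq V] {T : SimpleGraph V}

/-- `S` arises from `S₀` by repeatedly adding a vertex that is adjacent to a present one. -/
inductive Grows (T : SimpleGraph V) (S₀ : Finset V) : Finset V → Prop
  | refl : Grows T S₀ S₀
  | step {S : Finset V} {p a : V} (h : Grows T S₀ S) (hp : p ∈ S) (ha : a ∉ S)
      (hpa : T.Adj p a) : Grows T S₀ (insert a S)

theorem Grows.univ_of_nonempty [Fintype V] (hT : T.Connected) {S₀ S : Finset V}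
    (h : Grows T S₀ S) (hS : S.Nonempty) : Grows T S₀ Finset.univ := by
  by_cases hu : S = Finset.univ
  · exact hu ▸ h
  · obtain ⟨x, hx⟩ : ∃ x, x ∉ S := by
      by_contra! hx
      exact hu (Finset.eq_univ_iff_forall.2 hx)
    obtain ⟨s, hs⟩ := hS
    obtain ⟨p, a, hpa, -, -, hp, ha⟩ := (hT.joinedIn s x).exists_adj_not (Q := (· ∈ S)) hs hx
    have := (h.step hp ha hpa).univ_of_nonempty hT ⟨a, by simp⟩
    exact this
termination_by Fintype.card V - S.card
decreasing_by
  rw [Finset.card_insert_of_notMem ha]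
  have : S.card < Fintype.card V := Finset.card_lt_univ_of_notMem hx
  omega

variable [DecidableRel T.Adj]

/-- The leaf has degree one and only the degree of `p` increases. The new factor equals the number
of insertions in `card_planarLists_fiber`. -/
theorem prod_degreeIn_insert {S : Finset V} {p a : V} (hp : p ∈ S) (ha : a ∉ S)
    (hpa : T.Adj p a) (huniq : ∀ q ∈ S, T.Adj q a → q = p) :
    ∏ x ∈ insert a S, (degreeIn T (insert a S) x)! =
      (degreeIn T S p + 1) * ∏ x ∈ S, (degreeIn T S x)! := by
  have h1 : degreeIn T (insert a S) a = 1 := by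
    rw [degreeIn, Finset.card_eq_one]
    refine ⟨p, ?_⟩
    ext q
    simp only [Finset.mem_filter, Finset.mem_insert, Finset.mem_singleton]
    constructor
    · rintro ⟨rfl | hq, hqa⟩
      · exact absurd hqa (T.loopless.irrefl _)
      · exact huniq q hq hqa.symm
    · rintro rfl
      exact ⟨.inr hp, hpa.symm⟩
  have h2 : degreeIn T (insert a S) p = degreeIn T S p + 1 := by
    rw [degreeIn_insert ha, if_pos hpa]
  have h3 : ∀ x ∈ S.erase p, (degreeIn T (insert a S) x)! = (degreeIn T S x)! := by
    intro x hx
    rw [Finset.mem_erase] at hx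
    rw [degreeIn_insert ha, if_neg fun h => hx.1 (huniq x hx.2 h), add_zero]
  rw [Finset.prod_insert ha, h1, ← Finset.mul_prod_erase _ _ hp, h2, Finset.prod_congr rfl h3,
    ← Finset.mul_prod_erase _ (fun x => (degreeIn T S x)!) hp, Nat.factorial_one, Nat.factorial_succ,
    one_mul, mul_assoc]

/-- The weight `g` is constant on each fibre of the map that deletes `a`, and all fibres have the
same size. -/
theorem ConnectedSet.sum_planarLists_insert (hT : T.IsTree) {S : Finset V}
    (hS : ConnectedSet T S) {p a : V} (hp : p ∈ S) (ha : a ∉ S) (hpa : T.Adj p a)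
    (g : List V → ℕ) (hg : ∀ l : List V, g (l.filter (· ≠ a)) = g l) :
    ∑ l ∈ planarLists T (insert a S) p, g l =
      (degreeIn T S p + 1) * ∑ m ∈ planarLists T S p, g m := by
  have hmaps : ∀ l ∈ planarLists T (insert a S) p,
      l.filter (· ≠ a) ∈ planarLists T S p := by
    intro l hl
    rw [mem_planarLists] at hl ⊢
    obtain ⟨hn, hm, hl, hh⟩ := hl
    refine ⟨hn.filter _, fun x => ?_, hl.sublist List.filter_sublist, ?_⟩
    · rw [List.mem_filter, hm, Finset.mem_insert, decide_eq_true_iff]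
      constructor
      · rintro ⟨h, hne⟩
        exact h.resolve_left hne
      · intro hx
        exact ⟨.inr hx, fun h => ha (h ▸ hx)⟩
    · obtain ⟨m, rfl⟩ := List.head?_eq_some_iff.1 hh
      rw [List.filter_cons_of_pos (by simpa using hpa.ne)]
      rfl
  rw [← Finset.sum_fiberwise_of_maps_to hmaps, Finset.mul_sum]
  refine Finset.sum_congr rfl fun m hm => ?_
  rw [Finset.sum_congr rfl fun l hl => by rw [← hg l, (Finset.mem_filter.1 hl).2],
    Finset.sum_const, card_planarLists_fiber hT hS hp ha hpa hm, smul_eq_mul]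

/-- Restriction of a uniformly random planar arrangement of a tree to a subtree gives a uniformly
random planar arrangement, up to rotation. -/
theorem Grows.sum_planarLists (hT : T.IsTree) {S₀ S : Finset V} (h : Grows T S₀ S)
    (hS₀ : ConnectedSet T S₀) (g : List V → ℕ) (hrot : ∀ l l', l ~r l' → g l = g l')
    (hg : ∀ a ∉ S₀, ∀ l : List V, g (l.filter (· ≠ a)) = g l) :
    ConnectedSet T S ∧ S₀ ⊆ S ∧ ∀ r₀ ∈ S₀, ∀ r ∈ S,
      (∏ x ∈ S₀, (degreeIn T S₀ x)!) * ∑ l ∈ planarLists T S r, g l =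
        (∏ x ∈ S, (degreeIn T S x)!) * ∑ l ∈ planarLists T S₀ r₀, g l := by
  induction h with
  | refl => exact ⟨hS₀, subset_rfl, fun r₀ h₀ r hr => by rw [sum_planarLists_root h₀ hr g hrot]⟩
  | @step S p a _ hp ha hpa ih =>
    obtain ⟨hS, hsub, ih⟩ := ih
    refine ⟨hS.insert_of_adj hp hpa, hsub.trans (Finset.subset_insert a S),
      fun r₀ h₀ r hr => ?_⟩
    rw [sum_planarLists_root hr (Finset.mem_insert_of_mem hp) g hrot,
      hS.sum_planarLists_insert hT hp ha hpa g (hg a fun h => ha (hsub h)),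
      prod_degreeIn_insert hp ha hpa fun q hq hqa => hS.eq_of_adj hT hp hq ha hpa hqa,
      mul_left_comm, ih r₀ h₀ p hp, mul_assoc]

variable [Fintype V]

/-- The number of planar arrangements with a given first vertex. -/
theorem card_planarLists_univ (hT : T.IsTree) (r : V) :
    (planarLists T Finset.univ r).card = ∏ x, (T.degree x)! := by
  have hg : Grows T {r} Finset.univ := Grows.refl.univ_of_nonempty hT.1 ⟨r, by simp⟩
  have h := (hg.sum_planarLists hT (connectedSet_singleton r) (fun _ => 1) (fun _ _ _ => rfl) fun _ _ _ => rfl).2.2 r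
    (by simp) r (by simp)
  have h2 : planarLists T {r} r = {[r]} := by
    ext l
    rw [mem_planarLists, Finset.mem_singleton]
    constructor
    · rintro ⟨hn, hm, -, hh⟩
      obtain ⟨m, rfl⟩ := List.head?_eq_some_iff.1 hh
      rw [List.cons.injEq]
      refine ⟨rfl, List.eq_nil_iff_forall_not_mem.2 fun x hx => ?_⟩
      have := (hm x).1 (by simp [hx])
      exact (List.nodup_cons.1 hn).1 ((Finset.mem_singleton.1 this) ▸ hx)
    · rintro rfl
      refine ⟨by simp, by simp, fun s u t v _ _ h => ?_, rfl⟩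
      simpa using h.length_le
  simpa [degreeIn_singleton, h2, degreeIn_univ] using h

end Growth

/-! ### Pairs of vertices separated by an edge -/

section Separation

variable {V : Type*}

theorem List.sublist_of_cons_sublist_append {a : V} {L x y : List V}
    (h : (a :: L).Sublist (x ++ a :: y)) (hx : a ∉ x) : L.Sublist y := by
  induction x with
  | nil => exact List.cons_sublist_cons.1 h
  | cons b x ih =>
    rw [List.mem_cons, not_or] at hx
    cases h with
    | cons _ h => exact ih h hx.2
    | cons_cons _ h => exact absurd rfl hx.1

/-- A rotation moves a final piece of `m` in front of `a`, where it cannot serve the pattern. So the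
rotation-invariant condition agrees with plain containment on lists that start with `a`. -/
theorem List.exists_isRotated_sublist_iff {a : V} {L m : List V} (hn : (a :: m).Nodup) :
    (∃ l, (a :: m) ~r l ∧ (a :: L).Sublist l) ↔ (a :: L).Sublist (a :: m) := by
  refine ⟨?_, fun h => ⟨_, .refl _, h⟩⟩
  rintro ⟨l, hl, hsub⟩
  obtain ⟨k, hk, rfl⟩ := List.isRotated_iff_mod.1 hl
  rw [List.rotate_eq_drop_append_take hk] at hsub
  rcases k with _ | k
  · simpa using hsub
  · rw [List.drop_succ_cons, List.take_succ_cons] at hsub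
    have := List.sublist_of_cons_sublist_append hsub
      fun h => (List.nodup_cons.1 hn).1 (List.mem_of_mem_drop h)
    exact (this.trans (List.take_sublist k m)).cons_cons a

variable [DecidableEq V]

/-- The pattern does not use `a`. Hence containment up to rotation is a statistic to which
`Grows.sum_planarLists` applies. -/
theorem List.exists_isRotated_filter_iff {a : V} {L l : List V} (ha : a ∉ L) :
    (∃ l', l.filter (· ≠ a) ~r l' ∧ L.Sublist l') ↔ ∃ l', l ~r l' ∧ L.Sublist l' := by
  constructor
  · rintro ⟨l', hl', hL⟩
    obtain ⟨k, hk, rfl⟩ := List.isRotated_iff_mod.1 hl'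
    rw [List.rotate_eq_drop_append_take hk] at hL
    obtain ⟨x, y, hxy, hx, hy⟩ :=
      List.filter_eq_append_iff.1 (List.take_append_drop k (l.filter (· ≠ a))).symm
    refine ⟨y ++ x, hxy ▸ List.isRotated_append, hL.trans ?_⟩
    rw [← hx, ← hy]
    exact List.filter_sublist.append List.filter_sublist
  · rintro ⟨l', ⟨k, rfl⟩, hL⟩
    have h := hL.filter (· ≠ a)
    rw [List.filter_ne_of_notMem ha] at h
    refine ⟨_, ?_, h⟩
    obtain ⟨k', hk, hk'⟩ := List.isRotated_iff_mod.1 (⟨k, rfl⟩ : l ~r l.rotate k)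
    rw [← hk', List.rotate_eq_drop_append_take hk, List.filter_append]
    nth_rewrite 1 [← List.take_append_drop k' l]
    rw [List.filter_append]
    exact List.isRotated_append

variable {T : SimpleGraph V} [Fintype V]

open scoped Classical in
/-- The number of planar arrangements starting with `u` in which the edge `uv` separates `w`
from `w'`. -/
def separations (T : SimpleGraph V) (u v w w' : V) : ℕ :=
  ((planarLists T Finset.univ u).filter fun l => [u, w, v, w'].Sublist l).card

theorem separations_eq_zero {u v w w' : V} (h : ¬ [u, w, v, w'].Nodup) :
    separations T u v w w' = 0 := by
  rw [separations, Finset.card_eq_zero, Finset.filter_eq_empty_iff]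
  exact fun l hl hsub => h ((mem_planarLists.1 hl).1.sublist hsub)

theorem mem_planarLists_univ {r : V} {l : List V} :
    l ∈ planarLists T Finset.univ r ↔
      l.Nodup ∧ (∀ x, x ∈ l) ∧ Noncrossing T l ∧ l.head? = some r := by
  simp [mem_planarLists]

/-- Vertices joined off `u` and `v` lie on the same side of `uv` in every noncrossing list, so the
replacement works list by list. -/
theorem separations_congr {u v w w' h h' : V} (huv : T.Adj u v)
    (hw : w ≠ u ∧ w ≠ v) (hw' : w' ≠ u ∧ w' ≠ v)
    (hh : T.JoinedIn (fun x => x ≠ u ∧ x ≠ v) h w)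
    (hh' : T.JoinedIn (fun x => x ≠ u ∧ x ≠ v) h' w') :
    separations T u v w w' = separations T u v h h' := by
  rw [separations, separations]
  congr 1
  refine Finset.filter_congr fun l hl => ?_
  obtain ⟨hn, hm, hc, hd⟩ := mem_planarLists_univ.1 hl
  obtain ⟨m, rfl⟩ := List.head?_eq_some_iff.1 hd
  rw [List.sublist_iff_pairwise hn.pairwise_idxOf, List.sublist_iff_pairwise hn.pairwise_idxOf]
  have hu0 : (u :: m).idxOf u = 0 := by simp
  have hne : ∀ {x y : V}, x ≠ y → (u :: m).idxOf x ≠ (u :: m).idxOf y :=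
    fun hxy h => hxy ((List.idxOf_inj (hm _)).1 h)
  have key : ∀ {a b}, T.JoinedIn (fun x => x ≠ u ∧ x ≠ v) a b → _ := fun hab =>
    hc.between_of_joinedIn hn huv (hm u) (hm v) (hab.mono fun x hx => ⟨hm x, hx⟩)
  have k1 := key hh
  have k2 := key hh.symm
  have k1' := key hh'
  have k2' := key hh'.symm
  have hhu := hh.symm.right hw
  have hhu' := hh'.symm.right hw'
  have n1 := hne hw.1
  have n2 := hne hw.2
  have n1' := hne hw'.1
  have n2' := hne hw'.2
  have n3 := hne hhu.1
  have n4 := hne hhu.2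
  have n3' := hne hhu'.1
  have n4' := hne hhu'.2
  have nuv := hne huv.ne
  simp only [List.pairwise_cons, List.mem_cons, List.not_mem_nil, or_false, forall_eq_or_imp,
    forall_eq, hm, true_and, implies_true, false_implies, and_true, List.Pairwise.nil]
  omega

variable [DecidableRel T.Adj]

/-- Restriction to the subtree on `u, v, h, h'` is uniform. That subtree is a star, with degree
product `3! = 6`, or a path, with `2! * 2! = 4`, and just one of its lists is `[u, h, v, h']`. -/
theorem separations_mul (hT : T.IsTree) {u v h h' p p' : V} (huv : T.Adj u v)
    (hp : p ∈ ({u, v} : Finset V)) (hp' : p' ∈ ({u, v} : Finset V)) (hph : T.Adj p h)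
    (hph' : T.Adj p' h') (hh : h ∉ ({u, v} : Finset V)) (hh' : h' ∉ ({u, v} : Finset V))
    (hne : h ≠ h') :
    (if p = p' then 6 else 4) * separations T u v h h' = ∏ x, (T.degree x)! := by
  have c1 : ConnectedSet T {v, u} :=
    (connectedSet_singleton u).insert_of_adj (Finset.mem_singleton_self u) huv
  rw [Finset.pair_comm v u] at c1
  have c2 := c1.insert_of_adj hp hph
  have hh'2 : h' ∉ insert h ({u, v} : Finset V) := by
    rw [Finset.mem_insert, not_or]
    exact ⟨hne.symm, hh'⟩
  have hp'2 : p' ∈ insert h ({u, v} : Finset V) := Finset.mem_insert_of_mem hp'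
  have c3 := c2.insert_of_adj hp'2 hph'
  set S : Finset V := insert h' (insert h {u, v}) with hS
  have hg : Grows T S Finset.univ := Grows.refl.univ_of_nonempty hT.1 ⟨h', by simp [hS]⟩
  have d1 : ∀ q ∈ ({u, v} : Finset V), degreeIn T {u, v} q = 1 := by
    intro q hq
    rw [degreeIn, Finset.card_eq_one]
    rcases Finset.mem_insert.1 hq with rfl | hq
    · exact ⟨v, by simp [Finset.filter_insert, Finset.filter_singleton, huv]⟩
    · rw [Finset.mem_singleton.1 hq]
      exact ⟨u, by simp [Finset.filter_insert, Finset.filter_singleton, huv.symm]⟩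
  have hP : ∏ x ∈ S, (degreeIn T S x)! = if p = p' then 6 else 4 := by
    rw [hS, prod_degreeIn_insert hp'2 hh'2 hph'
      fun q hq hqa => c2.eq_of_adj hT hp'2 hq hh'2 hph' hqa,
      prod_degreeIn_insert hp hh hph fun q hq hqa => c1.eq_of_adj hT hp hq hh hph hqa,
      degreeIn_insert hh, d1 p hp, d1 p' hp', Finset.prod_pair huv.ne, d1 u (by simp),
      d1 v (by simp)]
    by_cases hpp : p = p'
    · subst hpp
      simp [hph]
    · rw [if_neg hpp, if_neg fun hadj => hpp (c1.eq_of_adj hT hp' hp hh hadj hph)]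
      rfl
  classical
  -- The transfer to a subtree needs a rotation-invariant statistic, hence containment up to
  -- rotation.
  let g : List V → ℕ := fun l => if ∃ l', l ~r l' ∧ [u, h, v, h'].Sublist l' then 1 else 0
  have hgrot : ∀ l l', l ~r l' → g l = g l' := by
    intro l l' hl
    have : (∃ l₁, l ~r l₁ ∧ [u, h, v, h'].Sublist l₁) ↔
        ∃ l₁, l' ~r l₁ ∧ [u, h, v, h'].Sublist l₁ :=
      ⟨fun ⟨l₁, h₁, h₂⟩ => ⟨l₁, hl.symm.trans h₁, h₂⟩, fun ⟨l₁, h₁, h₂⟩ => ⟨l₁, hl.trans h₁, h₂⟩⟩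
    simp only [g, this]
  have hgfil : ∀ a ∉ S, ∀ l : List V, g (l.filter (· ≠ a)) = g l := by
    intro a ha l
    have ha' : a ∉ [u, h, v, h'] := by
      simp only [hS, Finset.mem_insert, Finset.mem_singleton, List.mem_cons, List.not_mem_nil,
        or_false] at ha ⊢
      tauto
    simp only [g, List.exists_isRotated_filter_iff ha']
  have hsum : ∀ R : Finset V, ∑ l ∈ planarLists T R u, g l =
      ((planarLists T R u).filter fun l => [u, h, v, h'].Sublist l).card := by
    intro R
    rw [Finset.card_filter]
    refine Finset.sum_congr rfl fun l hl => ?_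
    obtain ⟨hn, -, -, hd⟩ := mem_planarLists.1 hl
    obtain ⟨m, rfl⟩ := List.head?_eq_some_iff.1 hd
    simp only [g, List.exists_isRotated_sublist_iff hn]
  have key := (hg.sum_planarLists hT c3 g hgrot hgfil).2.2 u (by simp [hS]) u (by simp)
  have hone : (planarLists T S u).filter (fun l => [u, h, v, h'].Sublist l) = {[u, h, v, h']} := by
    have hh0 := hh
    simp only [Finset.mem_insert, Finset.mem_singleton, not_or] at hh hh'
    have hnd : [u, h, v, h'].Nodup := by
      simp [hne, huv.ne, Ne.symm hh.1, hh.2, Ne.symm hh'.1, Ne.symm hh'.2]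
    ext l
    rw [Finset.mem_filter, mem_planarLists, Finset.mem_singleton]
    constructor
    · rintro ⟨⟨hn, hm, -, -⟩, hsub⟩
      refine (hsub.eq_of_length_le ?_).symm
      have := (List.perm_ext_iff_of_nodup hn hnd).2 fun x => by
        rw [hm, hS]
        simp only [Finset.mem_insert, Finset.mem_singleton, List.mem_cons, List.not_mem_nil,
          or_false]
        tauto
      exact this.length_eq.le
    · rintro rfl
      refine ⟨⟨hnd, fun x => ?_, fun s a t b hst hab hsub => ?_, rfl⟩, .refl _⟩
      · rw [hS]
        simp only [Finset.mem_insert, Finset.mem_singleton, List.mem_cons, List.not_mem_nil,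
          or_false]
        tauto
      -- A crossing here would use an edge `hh'`, but the only neighbour of `h'` among the other
      -- three vertices is `p'`.
      · have := hsub.eq_of_length_le (by simp)
        simp only [List.cons.injEq, and_true] at this
        rw [this.2.1, this.2.2.2] at hab
        exact hh0 (c2.eq_of_adj hT hp'2 (Finset.mem_insert_self _ _) hh'2 hph' hab ▸ hp')
  rw [hP, hsum, hsum, hone, Finset.card_singleton, mul_one] at key
  simp only [degreeIn_univ] at key
  rw [separations, ← key]

end Separation

/-! ### Summing separations over the two sides of an edge -/

section SideSums

variable {V : Type*} {T : SimpleGraph V}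

theorem SimpleGraph.IsTree.branch_side (hT : T.IsTree) {p q w : V} (hpq : T.Adj p q)
    (hw : w ≠ p) (hwq : T.branch p w ≠ q) : w ≠ q ∧ T.Adj p (T.branch p w) ∧
      T.JoinedIn (fun x => x ≠ p ∧ x ≠ q) (T.branch p w) w := by
  have h := hT.branch_spec hw
  refine ⟨?_, h.1, ?_⟩
  · rintro rfl
    exact hwq (hT.2.branch_adj hpq)
  · exact (hT.2.joinedIn_of_ne (P := fun _ => True) h.1 hpq hwq
      (h.2.mono fun _ h => ⟨trivial, h⟩)).mono fun _ h => h.2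

theorem List.card_filter_idxOf [Fintype V] [DecidableEq V] {l : List V} (hn : l.Nodup)
    (hm : ∀ x, x ∈ l)
    (P : ℕ → Prop) [DecidablePred P] : (Finset.univ.filter fun x => P (l.idxOf x)).card =
      ((Finset.range (Fintype.card V)).filter P).card := by
  have hlen : l.length = Fintype.card V := by
    rw [← List.toFinset_card_of_nodup hn, ← Finset.card_univ]
    congr 1
    ext x
    simp [hm]
  rw [← hlen]
  refine Finset.card_bij (fun x _ => l.idxOf x) ?_ ?_ ?_
  · intro x hx
    rw [Finset.mem_filter] at hx ⊢
    exact ⟨Finset.mem_range.2 (List.idxOf_lt_length_iff.2 (hm x)), hx.2⟩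
  · intro x _ y _ h
    exact (List.idxOf_inj (hm x)).1 h
  · intro i hi
    rw [Finset.mem_filter, Finset.mem_range] at hi
    refine ⟨l[i], ?_, hn.idxOf_getElem i hi.1⟩
    rw [Finset.mem_filter, hn.idxOf_getElem]
    exact ⟨Finset.mem_univ _, hi.2⟩

variable [Fintype V] [DecidableEq V]

/-- The vertices other than `p` on the side of `p` of an edge `pq`. -/
def sideOf (T : SimpleGraph V) (p q : V) : Finset V :=
  Finset.univ.filter fun w => w ≠ p ∧ T.branch p w ≠ q

theorem mem_sideOf {p q w : V} : w ∈ sideOf T p q ↔ w ≠ p ∧ T.branch p w ≠ q := by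
  simp [sideOf]

theorem sum_eq_sideOf_add {M : Type*} [AddCommMonoid M] (hT : T.IsTree) {u v : V}
    (huv : T.Adj u v) (f : V → M) (hu : f u = 0) (hv : f v = 0) :
    ∑ w, f w = ∑ w ∈ sideOf T u v, f w + ∑ w ∈ sideOf T v u, f w := by
  rw [← Finset.sum_union]
  · symm
    refine Finset.sum_subset (Finset.subset_univ _) fun w _ hw => ?_
    rw [Finset.mem_union, mem_sideOf, mem_sideOf, not_or] at hw
    have h := hT.branch_iff huv w
    by_cases hwu : w = u
    · rw [hwu, hu]
    by_cases hwv : w = v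
    · rw [hwv, hv]
    tauto
  · rw [Finset.disjoint_left]
    intro w hw hw'
    rw [mem_sideOf] at hw hw'
    have h := hT.branch_iff huv w
    tauto

theorem card_sideOf (hT : T.IsTree) {u v : V} (huv : T.Adj u v) :
    (sideOf T u v).card + 1 = T.branchSize v u := by
  have h := hT.branchSize_add huv
  have h2 : (sideOf T u v).card + 1 + T.branchSize u v = Fintype.card V := by
    have h3 : insert u (sideOf T u v) =
        Finset.univ.filter fun x => ¬ (x ≠ u ∧ T.branch u x = v) := by
      ext x
      simp only [Finset.mem_insert, mem_sideOf, Finset.mem_filter, Finset.mem_univ, true_and]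
      tauto
    rw [← Finset.card_insert_of_notMem (a := u) (by simp [mem_sideOf]), h3,
      SimpleGraph.branchSize, add_comm, Finset.card_filter_add_card_filter_not, Finset.card_univ]
  omega

/-- With `v` at position `k` there are `k - 1` vertices between `u` and `v`, and `n - 1 - k` after
`v`. -/
theorem card_between {u v : V} {l : List V} (huv : u ≠ v) (hl : l ∈ planarLists T Finset.univ u) :
    ((l.idxOf v : ℤ) - 1) * (Fintype.card V - 1 - l.idxOf v) =
      ∑ w, ∑ w', if [u, w, v, w'].Sublist l then (1 : ℤ) else 0 := by
  obtain ⟨hn, hm, -, hd⟩ := mem_planarLists_univ.1 hl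
  obtain ⟨m, rfl⟩ := List.head?_eq_some_iff.1 hd
  set l := u :: m with hldef
  have hu0 : l.idxOf u = 0 := by simp [hldef]
  have hv0 : l.idxOf v ≠ 0 := fun h => huv ((List.idxOf_inj (hm u)).1 (hu0.trans h.symm))
  have hvn : l.idxOf v < Fintype.card V := by
    have := List.idxOf_lt_length_iff.2 (hm v)
    rw [← List.toFinset_card_of_nodup hn] at this
    exact this.trans_le (Finset.card_le_univ _)
  have h1 : ∀ w w', (if [u, w, v, w'].Sublist l then (1 : ℤ) else 0) =
      (if 0 < l.idxOf w ∧ l.idxOf w < l.idxOf v then (1 : ℤ) else 0) *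
        if l.idxOf v < l.idxOf w' then (1 : ℤ) else 0 := by
    intro w w'
    rw [ite_zero_mul_ite_zero, mul_one]
    congr 1
    rw [List.sublist_iff_pairwise hn.pairwise_idxOf, eq_iff_iff]
    simp only [List.pairwise_cons, List.mem_cons, List.not_mem_nil, or_false, forall_eq_or_imp,
      forall_eq, hm, true_and, implies_true, false_implies, and_true, List.Pairwise.nil, hu0]
    omega
  simp only [h1, ← Finset.mul_sum, ← Finset.sum_mul]
  rw [Finset.sum_boole, Finset.sum_boole,
    List.card_filter_idxOf hn hm fun i => 0 < i ∧ i < l.idxOf v,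
    List.card_filter_idxOf hn hm fun i => l.idxOf v < i]
  have c1 : (Finset.range (Fintype.card V)).filter (fun i => 0 < i ∧ i < l.idxOf v) =
      Finset.Ioo 0 (l.idxOf v) := by
    ext i
    simp
    omega
  have c2 : (Finset.range (Fintype.card V)).filter (fun i => l.idxOf v < i) =
      Finset.Ioo (l.idxOf v) (Fintype.card V) := by
    ext i
    simp [and_comm]
  rw [c1, c2, Nat.card_Ioo, Nat.card_Ioo]
  congr 1 <;> omega

variable [DecidableRel T.Adj]

/-- The sum of the squares of the sizes of the branches at `u` other than that of `v`. -/
def otherSquares (T : SimpleGraph V) [DecidableRel T.Adj] (u v : V) : ℤ :=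
  ∑ c ∈ (T.neighborFinset u).erase v, (T.branchSize u c : ℤ) ^ 2

theorem sum_sideOf_same (hT : T.IsTree) (u v : V) :
    ∑ w ∈ sideOf T u v, ∑ w' ∈ sideOf T u v,
      (if T.branch u w = T.branch u w' then (1 : ℤ) else 0) = otherSquares T u v := by
  have hmaps : ∀ w ∈ sideOf T u v, T.branch u w ∈ (T.neighborFinset u).erase v := by
    intro w hw
    rw [mem_sideOf] at hw
    rw [Finset.mem_erase, SimpleGraph.mem_neighborFinset]
    exact ⟨hw.2, (hT.branch_spec hw.1).1⟩
  have hfib : ∀ c ∈ (T.neighborFinset u).erase v,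
      ((sideOf T u v).filter fun w => T.branch u w = c).card = T.branchSize u c := by
    intro c hc
    rw [SimpleGraph.branchSize]
    congr 1
    ext w
    simp only [Finset.mem_filter, mem_sideOf, Finset.mem_univ, true_and]
    constructor
    · rintro ⟨⟨h1, -⟩, h2⟩
      exact ⟨h1, h2⟩
    · rintro ⟨h1, rfl⟩
      exact ⟨⟨h1, (Finset.mem_erase.1 hc).1⟩, rfl⟩
  rw [← Finset.sum_fiberwise_of_maps_to hmaps, otherSquares]
  refine Finset.sum_congr rfl fun c hc => ?_
  rw [Finset.sum_congr rfl fun w hw => by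
    rw [(Finset.mem_filter.1 hw).2]]
  rw [Finset.sum_const, Finset.sum_boole, Finset.filter_congr fun x _ => eq_comm (a := c), hfib c hc,
    nsmul_eq_mul, sq]

/-- Vertices of one branch are never separated. Vertices of different branches are separated, in the
given order, in a sixth or a quarter of the lists, according as they hang from the same end of `uv`
or from different ends. -/
theorem separations_sideOf (hT : T.IsTree) {u v p q p' q' w w' : V} (huv : T.Adj u v)
    (hp : p = u ∧ q = v ∨ p = v ∧ q = u) (hp' : p' = u ∧ q' = v ∨ p' = v ∧ q' = u)
    (hw : w ∈ sideOf T p q) (hw' : w' ∈ sideOf T p' q') :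
    ((if p = p' then 6 else 4) * separations T u v w w' : ℤ) =
      if T.branch p w = T.branch p' w' then 0 else ∏ x, ((T.degree x)! : ℤ) := by
  have key : ∀ {p q w : V}, (p = u ∧ q = v ∨ p = v ∧ q = u) → w ∈ sideOf T p q →
      (w ≠ u ∧ w ≠ v) ∧ T.Adj p (T.branch p w) ∧ p ∈ ({u, v} : Finset V) ∧
      T.JoinedIn (fun x => x ≠ u ∧ x ≠ v) (T.branch p w) w := by
    intro p q w hp hw
    rw [mem_sideOf] at hw
    rcases hp with ⟨rfl, rfl⟩ | ⟨rfl, rfl⟩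
    · obtain ⟨h1, h2, h3⟩ := hT.branch_side huv hw.1 hw.2
      exact ⟨⟨hw.1, h1⟩, h2, by simp, h3⟩
    · obtain ⟨h1, h2, h3⟩ := hT.branch_side huv.symm hw.1 hw.2
      exact ⟨⟨h1, hw.1⟩, h2, by simp, h3.mono fun _ h => ⟨h.2, h.1⟩⟩
  obtain ⟨hw1, hph, hpm, hj⟩ := key hp hw
  obtain ⟨hw1', hph', hpm', hj'⟩ := key hp' hw'
  rw [separations_congr huv hw1 hw1' hj hj']
  split_ifs with h1 h2 h2
  · rw [separations_eq_zero (by simp [h2])]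
    simp
  · have := separations_mul hT huv hpm hpm' hph hph' (by simpa using hj.symm.right hw1)
      (by simpa using hj'.symm.right hw1') h2
    rw [if_pos h1] at this
    exact_mod_cast this
  · rw [separations_eq_zero (by simp [h2])]
    simp
  · have := separations_mul hT huv hpm hpm' hph hph' (by simpa using hj.symm.right hw1)
      (by simpa using hj'.symm.right hw1') h2
    rw [if_neg h1] at this
    exact_mod_cast this

/-- Pairs on one side have weight `1/6`, except that those in a common branch drop out, which
subtracts the squares. Mixed pairs have weight `1/4` and occur in both orders, whence the
coefficient `3 = 2 * 6 / 4`. -/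
theorem sum_separations (hT : T.IsTree) {u v : V} (huv : T.Adj u v) :
    (6 * ∑ w, ∑ w', (separations T u v w w' : ℤ)) = (∏ x, ((T.degree x)! : ℤ)) *
      (((T.branchSize v u : ℤ) - 1) ^ 2 + ((T.branchSize u v : ℤ) - 1) ^ 2 +
        3 * ((T.branchSize v u : ℤ) - 1) * ((T.branchSize u v : ℤ) - 1) -
        otherSquares T u v - otherSquares T v u) := by
  set M : ℤ := ∏ x, ((T.degree x)! : ℤ) with hM
  have hz : ∀ w w', ¬ [u, w, v, w'].Nodup → (separations T u v w w' : ℤ) = 0 := fun w w' h => by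
    rw [separations_eq_zero h, Nat.cast_zero]
  rw [sum_eq_sideOf_add hT huv _ (Finset.sum_eq_zero fun w' _ => hz _ _ (by simp))
    (Finset.sum_eq_zero fun w' _ => hz _ _ (by simp)),
    Finset.sum_congr rfl fun w _ => sum_eq_sideOf_add hT huv _ (hz w u (by simp))
      (hz w v (by simp)),
    Finset.sum_congr (s₁ := sideOf T v u) rfl fun w _ => sum_eq_sideOf_add hT huv _
      (hz w u (by simp)) (hz w v (by simp)), Finset.sum_add_distrib, Finset.sum_add_distrib]
  have same : ∀ p q, (p = u ∧ q = v ∨ p = v ∧ q = u) →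
      6 * ∑ w ∈ sideOf T p q, ∑ w' ∈ sideOf T p q, (separations T u v w w' : ℤ) =
        M * (((T.branchSize q p : ℤ) - 1) ^ 2 - otherSquares T p q) := by
    intro p q hp
    have hpq : T.Adj p q := by
      rcases hp with ⟨rfl, rfl⟩ | ⟨rfl, rfl⟩
      · exact huv
      · exact huv.symm
    have h1 : ∀ w ∈ sideOf T p q, ∀ w' ∈ sideOf T p q, 6 * (separations T u v w w' : ℤ) =
        M * (1 - if T.branch p w = T.branch p w' then (1 : ℤ) else 0) := by
      intro w hw w' hw'
      have := separations_sideOf hT huv hp hp hw hw'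
      rw [if_pos rfl] at this
      rw [this]
      split_ifs <;> simp [hM]
    simp only [Finset.mul_sum]
    rw [Finset.sum_congr rfl fun w hw => Finset.sum_congr rfl (h1 w hw)]
    simp only [← Finset.mul_sum, Finset.sum_sub_distrib, Finset.sum_const, sum_sideOf_same hT,
      ← card_sideOf hT hpq]
    push_cast
    simp
    ring_nf
    simp
  have diff : ∀ p q, (p = u ∧ q = v ∨ p = v ∧ q = u) →
      4 * ∑ w ∈ sideOf T p q, ∑ w' ∈ sideOf T q p, (separations T u v w w' : ℤ) =
        M * (((T.branchSize q p : ℤ) - 1) * ((T.branchSize p q : ℤ) - 1)) := by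
    intro p q hp
    have hpq : T.Adj p q := by
      rcases hp with ⟨rfl, rfl⟩ | ⟨rfl, rfl⟩
      · exact huv
      · exact huv.symm
    have h1 : ∀ w ∈ sideOf T p q, ∀ w' ∈ sideOf T q p, 4 * (separations T u v w w' : ℤ) = M := by
      intro w hw w' hw'
      have := separations_sideOf hT huv hp (by tauto) hw hw'
      rw [if_neg hpq.ne] at this
      rw [this, if_neg, hM]
      intro h
      rw [mem_sideOf] at hw hw'
      have a1 := (hT.branch_spec hw.1).1
      have a2 := (hT.branch_spec hw'.1).1
      rw [← h] at a2
      exact hpq.ne (hT.2.eq_of_joinedIn a1.symm a2.symm (.of_adj hpq a1.ne a2.ne))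
    simp only [Finset.mul_sum]
    rw [Finset.sum_congr rfl fun w hw => Finset.sum_congr rfl (h1 w hw)]
    simp only [Finset.sum_const, ← card_sideOf hT hpq, ← card_sideOf hT hpq.symm]
    push_cast
    simp
    ring
  have s1 := same u v (by simp)
  have s2 := same v u (by simp)
  have d1 := diff u v (by simp)
  have d2 := diff v u (by simp)
  -- The mixed sums enter with the factor `6 / 4`; doubling keeps the combination integral.
  refine mul_left_cancel₀ (two_ne_zero' ℤ) ?_
  linear_combination 2 * s1 + 2 * s2 + 3 * d1 + 3 * d2

/-- The sum of the products of the two circular distances between the ends of an edge, over the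
planar arrangements that start with one of them. -/
theorem sum_planarLists_gap (hT : T.IsTree) {u v : V} (huv : T.Adj u v) :
    6 * ∑ l ∈ planarLists T Finset.univ u,
      (l.idxOf v : ℤ) * ((Fintype.card V : ℤ) - l.idxOf v) =
    (∏ x, ((T.degree x)! : ℤ)) * ((Fintype.card V : ℤ) ^ 2 + Fintype.card V - 1 +
      T.branchSize u v * T.branchSize v u - otherSquares T u v - otherSquares T v u) := by
  classical
  -- This is `k (n - k) = (n - 1) + (k - 1) (n - 1 - k)`, with the product expanded into separated
  -- pairs.
  have h1 : ∀ l ∈ planarLists T Finset.univ u,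
      (l.idxOf v : ℤ) * ((Fintype.card V : ℤ) - l.idxOf v) =
        (Fintype.card V - 1) + ∑ w, ∑ w', if [u, w, v, w'].Sublist l then (1 : ℤ) else 0 := by
    intro l hl
    rw [← card_between huv.ne hl]
    ring
  have h2 : ∑ l ∈ planarLists T Finset.univ u, ∑ w, ∑ w',
      (if [u, w, v, w'].Sublist l then (1 : ℤ) else 0) =
      ∑ w, ∑ w', (separations T u v w w' : ℤ) := by
    rw [Finset.sum_comm]
    refine Finset.sum_congr rfl fun w _ => ?_
    rw [Finset.sum_comm]
    refine Finset.sum_congr rfl fun w' _ => ?_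
    rw [Finset.sum_boole, separations]
  rw [Finset.sum_congr rfl h1, Finset.sum_add_distrib, h2, Finset.sum_const,
    card_planarLists_univ hT, mul_add, sum_separations hT huv, nsmul_eq_mul, Nat.cast_prod]
  have h3 : (T.branchSize u v : ℤ) + T.branchSize v u = Fintype.card V := by
    exact_mod_cast hT.branchSize_add huv
  rw [← h3]
  ring

end SideSums

section Arrangements

/-! ### Arrangements and lists -/

variable {V : Type*} [Fintype V]

/-- The vertices in the order of the arrangement. -/
def Arrangement.toList (π : Arrangement V) : List V :=
  (List.finRange (Fintype.card V)).map π.symm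

theorem Arrangement.nodup_toList (π : Arrangement V) : π.toList.Nodup :=
  (List.nodup_finRange _).map π.symm.injective

theorem Arrangement.mem_toList (π : Arrangement V) (x : V) : x ∈ π.toList :=
  List.mem_map.2 ⟨π x, List.mem_finRange _, π.symm_apply_apply x⟩

theorem Arrangement.length_toList (π : Arrangement V) : π.toList.length = Fintype.card V := by
  simp [Arrangement.toList]

theorem Arrangement.idxOf_toList [DecidableEq V] (π : Arrangement V) (x : V) :
    π.toList.idxOf x = π x := by
  have h : (π x : ℕ) < π.toList.length := by
    rw [π.length_toList]
    exact (π x).2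
  have := π.nodup_toList.idxOf_getElem _ h
  rwa [show π.toList[(π x : ℕ)] = x by simp [Arrangement.toList]] at this

theorem Arrangement.pairwise_toList (π : Arrangement V) :
    π.toList.Pairwise fun a b => (π a : ℕ) < π b := by
  classical
  simpa only [π.idxOf_toList] using π.nodup_toList.pairwise_idxOf

theorem crossings_eq_zero_iff (T : SimpleGraph V) (π : Arrangement V) :
    crossings T π = 0 ↔ Noncrossing T π.toList := by
  rw [crossings, Set.ncard_eq_zero (Set.toFinite _), Set.eq_empty_iff_forall_notMem]
  constructor
  · intro h s u t v hst huv hsub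
    refine h ((s, t), (u, v)) ⟨hst, huv, ?_⟩
    have := ((List.sublist_iff_pairwise π.pairwise_toList _).1 hsub).2
    simp only [List.pairwise_cons, List.mem_cons, List.not_mem_nil, or_false, forall_eq_or_imp,
      forall_eq] at this
    exact ⟨Fin.lt_def.2 this.1.1, Fin.lt_def.2 this.2.1.1, Fin.lt_def.2 this.2.2.1⟩
  · rintro h ⟨⟨s, t⟩, u, v⟩ ⟨hst, huv, h1, h2, h3⟩
    exact h.not_lt π.pairwise_toList (π.mem_toList _) (π.mem_toList _) (π.mem_toList _)
      (π.mem_toList _) hst huv h1 h2 h3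

theorem mem_planarArrangements {T : SimpleGraph V} {π : Arrangement V} :
    π ∈ planarArrangements T ↔ Noncrossing T π.toList := by
  rw [planarArrangements, Set.mem_ofPred_eq, crossings_eq_zero_iff]

variable [DecidableEq V]

theorem Arrangement.exists_toList {l : List V} (hn : l.Nodup) (hm : ∀ x, x ∈ l) :
    ∃ π : Arrangement V, π.toList = l := by
  have hlen : l.length = Fintype.card V := by
    rw [← List.toFinset_card_of_nodup hn, ← Finset.card_univ]
    congr 1
    ext x
    simp [hm]
  have hlt : ∀ x, l.idxOf x < Fintype.card V := fun x => by
    rw [← hlen]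
    exact List.idxOf_lt_length_iff.2 (hm x)
  have hb : Function.Bijective fun x => (⟨l.idxOf x, hlt x⟩ : Fin (Fintype.card V)) := by
    rw [Fintype.bijective_iff_injective_and_card]
    refine ⟨fun x y h => ?_, by simp⟩
    exact (List.idxOf_inj (hm x)).1 (Fin.mk.inj h)
  refine ⟨Equiv.ofBijective _ hb, ?_⟩
  set π : Arrangement V := Equiv.ofBijective _ hb
  refine List.ext_getElem (by rw [π.length_toList, hlen]) fun i h1 h2 => ?_
  refine (List.idxOf_inj (l := l) (hm _)).1 ?_
  rw [hn.idxOf_getElem]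
  have h3 : (π (π.toList[i]) : ℕ) = i := by
    rw [← π.idxOf_toList, π.nodup_toList.idxOf_getElem]
  exact h3

theorem Arrangement.toList_injective :
    Function.Injective (Arrangement.toList : Arrangement V → List V) := by
  intro π π' h
  refine Equiv.ext fun x => Fin.ext ?_
  rw [← π.idxOf_toList, ← π'.idxOf_toList, h]

open scoped Classical in
/-- A planar arrangement is a rotation of one that starts with a given vertex. -/
theorem sum_planarArrangements {T : SimpleGraph V} {M : Type*} [AddCommMonoid M] (r : V)
    (F : List V → M) :
    ∑ π ∈ (planarArrangements T).toFinset, F (Arrangement.toList π) =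
      ∑ l ∈ planarLists T Finset.univ r, ∑ i ∈ Finset.range (Fintype.card V), F (l.rotate i) := by
  have hlen : ∀ l ∈ planarLists T Finset.univ r, l.length = Fintype.card V := by
    intro l hl
    obtain ⟨hn, hm, -, -⟩ := mem_planarLists_univ.1 hl
    obtain ⟨π, rfl⟩ := Arrangement.exists_toList hn hm
    exact π.length_toList
  rw [← Finset.sum_product']
  symm
  have hex : ∀ q : List V × ℕ, q ∈ planarLists T Finset.univ r ×ˢ Finset.range (Fintype.card V) →
      ∃ π : Arrangement V, π.toList = q.1.rotate q.2 := by
    intro q hq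
    obtain ⟨hn, hm, -, -⟩ := mem_planarLists_univ.1 (Finset.mem_product.1 hq).1
    exact Arrangement.exists_toList (List.nodup_rotate.2 hn)
      fun x => List.mem_rotate.2 (hm x)
  refine Finset.sum_bij (fun q hq => (hex q hq).choose) ?_ ?_ ?_ ?_
  · intro q hq
    rw [Set.mem_toFinset, mem_planarArrangements, (hex q hq).choose_spec]
    obtain ⟨-, -, hc, -⟩ := mem_planarLists_univ.1 (Finset.mem_product.1 hq).1
    exact hc.isRotated ⟨_, rfl⟩
  · rintro ⟨l, i⟩ hq ⟨l', i'⟩ hq' h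
    have h : l.rotate i = l'.rotate i' := by
      have h1 := (hex _ hq).choose_spec
      have h2 := (hex _ hq').choose_spec
      rw [h] at h1
      exact h1.symm.trans h2
    rw [Finset.mem_product, Finset.mem_range] at hq hq'
    obtain ⟨hn, -, -, hd⟩ := mem_planarLists_univ.1 hq.1
    obtain ⟨-, -, -, hd'⟩ := mem_planarLists_univ.1 hq'.1
    have hll : l = l' := by
      obtain ⟨m, rfl⟩ := List.head?_eq_some_iff.1 hd
      obtain ⟨m', rfl⟩ := List.head?_eq_some_iff.1 hd'
      have hr : (r :: m) ~r (r :: m') :=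
        List.IsRotated.trans ⟨i, rfl⟩ (h ▸ List.IsRotated.symm ⟨i', rfl⟩)
      rw [hr.eq_of_cons hn]
    subst hll
    rcases hn.rotate_congr_iff.1 h with h | rfl
    · rw [hlen l hq.1, Nat.mod_eq_of_lt hq.2, Nat.mod_eq_of_lt hq'.2] at h
      exact Prod.ext rfl h
    · simp at hd
  · intro π hπ
    rw [Set.mem_toFinset, mem_planarArrangements] at hπ
    have hk : π.toList.idxOf r < π.toList.length := List.idxOf_lt_length_iff.2 (π.mem_toList r)
    set k := π.toList.idxOf r with hkdef
    have hl : π.toList.rotate k ∈ planarLists T Finset.univ r := by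
      refine mem_planarLists_univ.2 ⟨List.nodup_rotate.2 π.nodup_toList,
        fun x => List.mem_rotate.2 (π.mem_toList x), hπ.isRotated ⟨_, rfl⟩, ?_⟩
      rw [List.head?_rotate hk, List.getElem?_eq_getElem hk, List.getElem_idxOf]
    have hpos : 0 < Fintype.card V := Fintype.card_pos_iff.2 ⟨r⟩
    -- Rotation by `n - k` undoes rotation by `k`; the remainder matters only for `k = 0`, where `n`
    -- is out of range.
    have hq : (π.toList.rotate k, (Fintype.card V - k) % Fintype.card V) ∈
        planarLists T Finset.univ r ×ˢ Finset.range (Fintype.card V) :=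
      Finset.mem_product.2 ⟨hl, Finset.mem_range.2 (Nat.mod_lt _ hpos)⟩
    refine ⟨_, hq, Arrangement.toList_injective ?_⟩
    rw [(hex _ hq).choose_spec]
    rw [π.length_toList] at hk
    have h1 := List.rotate_mod (π.toList.rotate k) (Fintype.card V - k)
    rw [List.length_rotate, π.length_toList] at h1
    rw [h1, List.rotate_rotate, Nat.add_sub_cancel' hk.le]
    have h2 := List.rotate_length π.toList
    rwa [π.length_toList] at h2
  · intro q hq
    rw [(hex q hq).choose_spec]

/-- Let `k` be the position of `v`. Rotations by `1, …, k` put `v` before `u`, at distance `n - k`;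
the other `n - k` rotations leave distance `k`. -/
theorem sum_rotate_dist {u v : V} {l : List V} (hn : l.Nodup) (hm : ∀ x, x ∈ l)
    (hd : l.head? = some u) (huv : u ≠ v) :
    ∑ i ∈ Finset.range (Fintype.card V),
      |((l.rotate i).idxOf u : ℤ) - (l.rotate i).idxOf v| =
      2 * ((l.idxOf v : ℤ) * (Fintype.card V - l.idxOf v)) := by
  have hlen : l.length = Fintype.card V := by
    obtain ⟨π, rfl⟩ := Arrangement.exists_toList hn hm
    exact π.length_toList
  obtain ⟨m, rfl⟩ := List.head?_eq_some_iff.1 hd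
  set l := u :: m with hldef
  have hu0 : l.idxOf u = 0 := by simp [hldef]
  have hv0 : l.idxOf v ≠ 0 := fun h => huv ((List.idxOf_inj (hm u)).1 (hu0.trans h.symm))
  have hvn : l.idxOf v < Fintype.card V := hlen ▸ List.idxOf_lt_length_iff.2 (hm v)
  set k := l.idxOf v
  set n := Fintype.card V
  have hidx : ∀ i j x, j < n → (j + i) % n = l.idxOf x → (l.rotate i).idxOf x = j := by
    intro i j x hj h
    have hj' : j < (l.rotate i).length := by rwa [List.length_rotate, hlen]
    have h1 := (List.nodup_rotate.2 hn : (l.rotate i).Nodup).idxOf_getElem j hj'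
    rw [List.getElem_rotate] at h1
    simp only [hlen, h, List.getElem_idxOf] at h1
    exact h1
  have hterm : ∀ i ∈ Finset.range n, |((l.rotate i).idxOf u : ℤ) - (l.rotate i).idxOf v| =
      (k : ℤ) + if 0 < i ∧ i ≤ k then (n : ℤ) - 2 * k else 0 := by
    intro i hi
    rw [Finset.mem_range] at hi
    rcases Nat.eq_zero_or_pos i with rfl | hi0
    · simp [hu0]
      rfl
    · rw [hidx i (n - i) u (by omega) (by rw [hu0, Nat.sub_add_cancel hi.le, Nat.mod_self])]
      by_cases hik : i ≤ k
      · rw [hidx i (k - i) v (by omega) (by rw [Nat.sub_add_cancel hik, Nat.mod_eq_of_lt hvn]),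
          if_pos ⟨hi0, hik⟩, abs_of_nonneg (by omega)]
        omega
      · rw [hidx i (n + k - i) v (by omega) (by
          rw [Nat.sub_add_cancel (by omega), Nat.add_mod_left, Nat.mod_eq_of_lt hvn]),
          if_neg (by omega), abs_of_nonpos (by omega)]
        omega
  rw [Finset.sum_congr rfl hterm, Finset.sum_add_distrib, ← Finset.sum_filter]
  have c : (Finset.range n).filter (fun i => 0 < i ∧ i ≤ k) = Finset.Ioc 0 k := by
    ext i
    simp
    omega
  rw [c]
  simp
  ring

end Arrangements

section Totals

/-! ### Sums over all arrangements and over the planar ones -/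

open scoped Classical in
theorem integral_uniformOn {Ω : Type*} [Fintype Ω] [MeasurableSpace Ω] [DiscreteMeasurableSpace Ω]
    (s : Set Ω) (f : Ω → ℝ) :
    ∫ x, f x ∂(uniformOn s) = (∑ x ∈ s.toFinset, f x) / s.ncard := by
  -- For the empty set the measure is zero, and the quotient is `0 / 0 = 0`.
  rcases s.eq_empty_or_nonempty with rfl | hs
  · simp
  have := isProbabilityMeasure_uniformOn s.toFinite hs
  rw [integral_fintype (Integrable.of_finite), Finset.sum_div, ← Finset.sum_filter_add_sum_filter_not
    Finset.univ (· ∈ s)]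
  have h1 : ∀ x, (uniformOn s).real {x} = if x ∈ s then (s.ncard : ℝ)⁻¹ else 0 := by
    intro x
    rw [measureReal_def, uniformOn, cond_apply s.toFinite.measurableSet]
    split_ifs with hx
    · rw [Set.inter_eq_self_of_subset_right (Set.singleton_subset_iff.2 hx),
        Measure.count_singleton, Measure.count_apply_finite _ s.toFinite,
        Set.ncard_eq_toFinset_card _ s.toFinite]
      simp
    · rw [Set.inter_singleton_eq_empty.2 hx]
      simp
  rw [Finset.sum_eq_zero (s := Finset.univ.filter fun x => ¬ x ∈ s), add_zero]
  · have : Finset.univ.filter (· ∈ s) = s.toFinset := by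
      ext
      simp
    rw [this]
    refine Finset.sum_congr rfl fun x hx => ?_
    rw [h1, if_pos (Set.mem_toFinset.1 hx), smul_eq_mul, div_eq_inv_mul]
  · intro x hx
    rw [h1, if_neg (Finset.mem_filter.1 hx).2, zero_smul]

theorem uniformOn_univ_real {Ω : Type*} [Fintype Ω] [MeasurableSpace Ω]
    [DiscreteMeasurableSpace Ω] (s : Set Ω) :
    (uniformOn (Set.univ : Set Ω)).real s = (s.ncard : ℝ) / Fintype.card Ω := by
  rw [measureReal_def, uniformOn_univ, Measure.count_apply_finite _ s.toFinite,
    ← Set.ncard_eq_toFinset_card _ s.toFinite]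
  simp

variable {V : Type*} [Fintype V]

theorem card_arrangement [DecidableEq V] : Fintype.card (Arrangement V) = (Fintype.card V)! :=
  Fintype.card_equiv (Fintype.equivFin V)

theorem setOf_one_le_crossings (T : SimpleGraph V) :
    {π : Arrangement V | 1 ≤ crossings T π} = (planarArrangements T)ᶜ := by
  ext π
  simp [planarArrangements, Nat.one_le_iff_ne_zero]

theorem ncard_compl_planarArrangements (T : SimpleGraph V) :
    ((planarArrangements T)ᶜ.ncard : ℝ) = ((Fintype.card V)! : ℝ) - numPlanar T := by
  classical
  rw [← card_arrangement, ← Nat.card_eq_fintype_card,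
    ← Set.ncard_add_ncard_compl (planarArrangements T), numPlanar]
  push_cast
  ring

theorem probNoCrossing_eq (T : SimpleGraph V) :
    probNoCrossing T = (numPlanar T : ℝ) / ((Fintype.card V)! : ℝ) := by
  classical
  rw [probNoCrossing, arrangementLaw, uniformOn_univ_real, card_arrangement]
  rfl

theorem probCrossing_eq (T : SimpleGraph V) :
    probCrossing T =
      (((Fintype.card V)! : ℝ) - (numPlanar T : ℝ)) / ((Fintype.card V)! : ℝ) := by
  classical
  rw [probCrossing, arrangementLaw, uniformOn_univ_real, card_arrangement,
    setOf_one_le_crossings, ncard_compl_planarArrangements]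

open scoped Classical in
-- Conditioning the uniform law on an event gives the uniform law on that event, here the complement
-- of the planar arrangements.
theorem expSumLengthsCrossing_eq [DecidableEq V] (T : SimpleGraph V) :
    expSumLengthsCrossing T = (∑ π, sumEdgeLengths T π -
      ∑ π ∈ (planarArrangements T).toFinset, sumEdgeLengths T π) /
        (((Fintype.card V)! : ℝ) - numPlanar T) := by
  rw [expSumLengthsCrossing, arrangementLaw, uniformOn, cond_cond_eq_cond_inter' MeasurableSet.univ
    (MeasurableSet.of_discrete) (by simp), Set.univ_inter, ← uniformOn, integral_uniformOn,
    setOf_one_le_crossings, ncard_compl_planarArrangements, Set.toFinset_compl,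
    ← Finset.sum_add_sum_compl (planarArrangements T).toFinset, add_sub_cancel_left]

theorem numPlanar_lt {T : SimpleGraph V} (h : ∃ π : Arrangement V, 1 ≤ crossings T π) :
    (numPlanar T : ℝ) < ((Fintype.card V)! : ℝ) := by
  rw [← sub_pos, ← ncard_compl_planarArrangements, ← setOf_one_le_crossings, Nat.cast_pos,
    Set.ncard_pos]
  exact h

theorem expSumLengthsCrossing_formula {T : SimpleGraph V}
    (h : ∃ π : Arrangement V, 1 ≤ crossings T π) :
    0 < probCrossing T ∧ expSumLengthsCrossing T =
      (expSumLengths T - expSumLengthsPlanar T * probNoCrossing T) / probCrossing T := by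
  classical
  have hlt := numPlanar_lt h
  have hpos : (0 : ℝ) < ((Fintype.card V)! : ℝ) := by exact_mod_cast Nat.factorial_pos _
  have hsub := sub_pos.2 hlt
  rw [probCrossing_eq, probNoCrossing_eq]
  refine ⟨div_pos hsub hpos, ?_⟩
  rw [expSumLengthsCrossing_eq, expSumLengths, expSumLengthsPlanar, arrangementLaw,
    integral_uniformOn, integral_uniformOn, Set.ncard_univ, Nat.card_eq_fintype_card,
    card_arrangement, ← numPlanar]
  simp only [Set.toFinset_univ]
  have h1 : (∑ π ∈ (planarArrangements T).toFinset, sumEdgeLengths T π) / (numPlanar T : ℝ) *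
      ((numPlanar T : ℝ) / ((Fintype.card V)! : ℝ)) =
      (∑ π ∈ (planarArrangements T).toFinset, sumEdgeLengths T π) / ((Fintype.card V)! : ℝ) := by
    -- A general graph may have no planar arrangement; then both sides vanish by the conventions for
    -- the empty sum and division by zero.
    by_cases h0 : numPlanar T = 0
    · have : planarArrangements T = ∅ := (Set.ncard_eq_zero (Set.toFinite _)).1 h0
      simp [this]
    · have : (numPlanar T : ℝ) ≠ 0 := by exact_mod_cast h0
      field_simp
  rw [h1]
  field_simp

theorem sum_abs_sub_range (n : ℕ) :
    3 * ∑ i ∈ Finset.range n, ∑ j ∈ Finset.range n, |(i : ℤ) - j| = (n : ℤ) ^ 3 - n := by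
  induction n with
  | zero => simp
  | succ n ih =>
    have h1 : ∑ i ∈ Finset.range n, |(i : ℤ) - n| = ∑ i ∈ Finset.range n, ((n : ℤ) - i) := by
      refine Finset.sum_congr rfl fun i hi => ?_
      rw [Finset.mem_range] at hi
      rw [abs_sub_comm, abs_of_nonneg (by omega)]
    have h2 : ∑ i ∈ Finset.range n, |(n : ℤ) - i| = ∑ i ∈ Finset.range n, ((n : ℤ) - i) := by
      rw [← h1]
      exact Finset.sum_congr rfl fun i _ => abs_sub_comm _ _
    have h3 : ∀ m : ℕ, 2 * ∑ i ∈ Finset.range m, (i : ℤ) = (m : ℤ) * (m - 1) := by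
      intro m
      induction m with
      | zero => simp
      | succ m ih =>
        rw [Finset.sum_range_succ, mul_add, ih]
        push_cast
        ring
    have h4 : 2 * ∑ i ∈ Finset.range n, ((n : ℤ) - i) = (n : ℤ) * (n + 1) := by
      rw [Finset.sum_sub_distrib, mul_sub, h3]
      simp
      ring
    rw [Finset.sum_range_succ, Finset.sum_range_succ]
    simp only [Finset.sum_range_succ (fun j => |((_ : ℕ) : ℤ) - (j : ℤ)|)]
    rw [Finset.sum_add_distrib, h1, h2]
    push_cast
    simp only [sub_self, abs_zero, add_zero]
    linear_combination ih + 3 * h4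

theorem sum_neighborFinset_comm {T : SimpleGraph V} [DecidableRel T.Adj] {M : Type*} [AddCommMonoid M] (f : V → V → M) :
    ∑ u, ∑ v ∈ T.neighborFinset u, f v u = ∑ u, ∑ v ∈ T.neighborFinset u, f u v := by
  simp only [SimpleGraph.neighborFinset_eq_filter, Finset.sum_filter]
  rw [Finset.sum_comm]
  simp only [T.adj_comm]

variable [DecidableEq V]

theorem sum_arrangement_dist_congr {u v u' v' : V} (h : u ≠ v) (h' : u' ≠ v') :
    ∑ π : Arrangement V, |((π u : ℕ) : ℤ) - (π v : ℕ)| =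
      ∑ π : Arrangement V, |((π u' : ℕ) : ℤ) - (π v' : ℕ)| := by
  -- The first swap sends `u` to `u'`; the second carries the image of `v` to `v'` and fixes `u'`.
  let σ : Equiv.Perm V := Equiv.swap (Equiv.swap u u' v) v' * Equiv.swap u u'
  have hu : σ u = u' := by
    simp only [σ, Equiv.Perm.mul_apply, Equiv.swap_apply_left]
    refine Equiv.swap_apply_of_ne_of_ne (fun h1 => h ?_) h'
    exact (Equiv.swap u u').injective ((Equiv.swap_apply_left u u').trans h1)
  have hv : σ v = v' := by
    simp [σ, Equiv.Perm.mul_apply]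
  rw [← Equiv.sum_comp (Equiv.equivCongr σ (Equiv.refl _)) fun π : Arrangement V =>
    |((π u' : ℕ) : ℤ) - (π v' : ℕ)|]
  refine Finset.sum_congr rfl fun π _ => ?_
  rw [← hu, ← hv]
  simp

/-- By symmetry all `n (n - 1)` ordered pairs contribute equally, and for each arrangement the
distances of all pairs add up to `(n ^ 3 - n) / 3`. -/
theorem sum_arrangement_dist {u v : V} (h : u ≠ v) :
    3 * ∑ π : Arrangement V, |((π u : ℕ) : ℤ) - (π v : ℕ)| =
      ((Fintype.card V)! : ℤ) * (Fintype.card V + 1) := by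
  set n := Fintype.card V with hn
  have h1 : ∑ x : V, ∑ y : V, ∑ π : Arrangement V, |((π x : ℕ) : ℤ) - (π y : ℕ)| =
      (n : ℤ) * (n - 1) * ∑ π : Arrangement V, |((π u : ℕ) : ℤ) - (π v : ℕ)| := by
    have h2 : ∀ x : V, ∑ y : V, ∑ π : Arrangement V, |((π x : ℕ) : ℤ) - (π y : ℕ)| =
        ((n : ℤ) - 1) * ∑ π : Arrangement V, |((π u : ℕ) : ℤ) - (π v : ℕ)| := by
      intro x
      rw [← Finset.add_sum_erase _ _ (Finset.mem_univ x), Finset.sum_congr rfl fun y hy =>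
        sum_arrangement_dist_congr (Finset.ne_of_mem_erase hy).symm h, Finset.sum_const,
        Finset.card_erase_of_mem (Finset.mem_univ x), Finset.card_univ, nsmul_eq_mul,
        Nat.cast_sub (Fintype.card_pos_iff.2 ⟨x⟩)]
      simp [hn]
    rw [Finset.sum_congr rfl fun x _ => h2 x, Finset.sum_const, Finset.card_univ, nsmul_eq_mul,
      mul_assoc]
  have h3 : 3 * ∑ x : V, ∑ y : V, ∑ π : Arrangement V, |((π x : ℕ) : ℤ) - (π y : ℕ)| =
      ((n)! : ℤ) * ((n : ℤ) ^ 3 - n) := by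
    have h4 : ∀ π : Arrangement V, ∑ x : V, ∑ y : V, |((π x : ℕ) : ℤ) - (π y : ℕ)| =
        ∑ i ∈ Finset.range n, ∑ j ∈ Finset.range n, |(i : ℤ) - j| := by
      intro π
      rw [Equiv.sum_comp π fun i => ∑ y : V, |((i : ℕ) : ℤ) - (π y : ℕ)|, Finset.sum_range]
      refine Finset.sum_congr rfl fun i _ => ?_
      rw [Equiv.sum_comp π fun j => |((i : ℕ) : ℤ) - (j : ℕ)|, Finset.sum_range]
    rw [Finset.sum_congr rfl fun x _ => Finset.sum_comm, Finset.sum_comm,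
      Finset.sum_congr rfl fun π _ => h4 π, Finset.sum_const, Finset.card_univ, card_arrangement,
      nsmul_eq_mul, mul_left_comm, sum_abs_sub_range]
  have hn2 : (2 : ℤ) ≤ n := by
    have : 1 < Fintype.card V := Fintype.one_lt_card_iff.2 ⟨u, v, h⟩
    omega
  have hne : (n : ℤ) * (n - 1) ≠ 0 := mul_ne_zero (by omega) (by omega)
  rw [h1] at h3
  refine mul_left_cancel₀ hne ?_
  linear_combination h3

variable {T : SimpleGraph V} [DecidableRel T.Adj]

theorem sum_neighborFinset_eq {M : Type*} [AddCommMonoid M] (f : Sym2 V → M) :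
    ∑ u, ∑ v ∈ T.neighborFinset u, f s(u, v) = 2 • ∑ e ∈ T.edgeFinset, f e := by
  have h1 : ∑ u, ∑ v ∈ T.neighborFinset u, f s(u, v) = ∑ d : T.Dart, f d.edge := by
    rw [Finset.sum_sigma']
    refine Finset.sum_bij' (fun q hq => ⟨(q.1, q.2), by simpa using hq⟩)
      (fun d _ => ⟨d.fst, d.snd⟩) ?_ ?_ ?_ ?_ ?_
    · intro q hq
      simp
    · intro d _
      simp [d.adj]
    · intro q hq
      rfl
    · intro d _
      rfl
    · intro q hq
      rfl
  have h2 : ∀ d ∈ (Finset.univ : Finset T.Dart), d.edge ∈ T.edgeFinset := fun d _ => by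
    rw [SimpleGraph.mem_edgeFinset]
    exact d.edge_mem
  rw [h1, ← Finset.sum_fiberwise_of_maps_to h2, Finset.smul_sum]
  refine Finset.sum_congr rfl fun e he => ?_
  rw [Finset.sum_congr rfl fun d hd => by rw [(Finset.mem_filter.1 hd).2], Finset.sum_const,
    SimpleGraph.dart_edge_fiber_card _ e (SimpleGraph.mem_edgeFinset.1 he)]

theorem two_mul_sumEdgeLengths (π : Arrangement V) :
    2 * sumEdgeLengths T π =
      ((∑ u, ∑ v ∈ T.neighborFinset u, |((π u : ℕ) : ℤ) - (π v : ℕ)| : ℤ) : ℝ) := by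
  have h := sum_neighborFinset_eq (T := T) (edgeLength π)
  rw [two_nsmul, ← two_mul] at h
  have h2 : sumEdgeLengths T π = ∑ e ∈ T.edgeFinset, edgeLength π e := by
    rw [sumEdgeLengths]
    congr!
  rw [h2, ← h]
  push_cast
  rfl

theorem SimpleGraph.IsTree.sum_neighborFinset_const (hT : T.IsTree) (c : ℤ) :
    ∑ u, ∑ _v ∈ T.neighborFinset u, c = 2 * ((Fintype.card V : ℤ) - 1) * c := by
  have h := sum_neighborFinset_eq (T := T) fun _ => c
  rw [h, Finset.sum_const, ← hT.card_edgeFinset]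
  simp
  ring

theorem sum_sumEdgeLengths (hT : T.IsTree) :
    3 * ∑ π, sumEdgeLengths T π =
      ((Fintype.card V)! : ℝ) * ((Fintype.card V : ℝ) ^ 2 - 1) := by
  have h : 2 * ∑ π, sumEdgeLengths T π =
      ((∑ u, ∑ v ∈ T.neighborFinset u, ∑ π : Arrangement V, |((π u : ℕ) : ℤ) - (π v : ℕ)| : ℤ) :
        ℝ) := by
    rw [Finset.mul_sum, Finset.sum_congr rfl fun π _ => two_mul_sumEdgeLengths π,
      ← Int.cast_sum, Finset.sum_comm]
    congr 1
    exact Finset.sum_congr rfl fun u _ => Finset.sum_comm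
  have h2 : 3 * ∑ u, ∑ v ∈ T.neighborFinset u, ∑ π : Arrangement V,
      |((π u : ℕ) : ℤ) - (π v : ℕ)| = 2 * ((Fintype.card V : ℤ) - 1) *
        (((Fintype.card V)! : ℤ) * (Fintype.card V + 1)) := by
    rw [← hT.sum_neighborFinset_const, Finset.mul_sum]
    refine Finset.sum_congr rfl fun u _ => ?_
    rw [Finset.mul_sum]
    refine Finset.sum_congr rfl fun v hv => ?_
    rw [sum_arrangement_dist ((T.mem_neighborFinset u v).1 hv).ne]
  have h3 := congrArg (fun z : ℤ => (z : ℝ)) h2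
  push_cast at h3 h
  linear_combination (3 / 2) * h + (1 / 2) * h3

theorem numPlanar_eq (hT : T.IsTree) :
    numPlanar T = Fintype.card V * ∏ x, (T.degree x)! := by
  classical
  obtain ⟨r⟩ := hT.1.nonempty
  have h := sum_planarArrangements (T := T) r fun _ => 1
  rw [Finset.sum_const, smul_eq_mul, mul_one] at h
  rw [numPlanar, Set.ncard_eq_toFinset_card', h]
  simp [card_planarLists_univ hT, mul_comm]

/-- The contribution of an edge to the expected sum of edge lengths in planar arrangements. -/
def planarWeight (T : SimpleGraph V) [DecidableRel T.Adj] (u v : V) : ℤ :=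
  T.branchSize u v * T.branchSize v u - ((T.degree u : ℤ) - 1) * (T.branchSize u v : ℤ) ^ 2 -
    ((T.degree v : ℤ) - 1) * (T.branchSize v u : ℤ) ^ 2

/-- As `v` runs over the neighbours of `u`, each branch at `u` is left out once, hence counted
`degree u - 1` times. The regrouped term of an edge involves only its own branch sizes and the
degrees of its ends. -/
theorem sum_otherSquares :
    ∑ u, ∑ v ∈ T.neighborFinset u, otherSquares T u v =
      ∑ u, ∑ v ∈ T.neighborFinset u, ((T.degree u : ℤ) - 1) * (T.branchSize u v : ℤ) ^ 2 := by
  refine Finset.sum_congr rfl fun u _ => ?_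
  have h : ∀ v ∈ T.neighborFinset u, otherSquares T u v =
      ∑ c ∈ T.neighborFinset u, (T.branchSize u c : ℤ) ^ 2 - (T.branchSize u v : ℤ) ^ 2 := by
    intro v hv
    rw [otherSquares, ← Finset.add_sum_erase _ _ hv]
    ring
  rw [Finset.sum_congr rfl h, Finset.sum_sub_distrib, Finset.sum_const, nsmul_eq_mul,
    ← Finset.mul_sum, sub_mul, one_mul, SimpleGraph.card_neighborFinset_eq_degree]

open scoped Classical in
theorem sum_sumEdgeLengths_planar (hT : T.IsTree) :
    6 * ∑ π ∈ (planarArrangements T).toFinset, sumEdgeLengths T π =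
      (((∏ x, ((T.degree x)! : ℤ)) * (2 * ((Fintype.card V : ℤ) - 1) *
        ((Fintype.card V : ℤ) ^ 2 + Fintype.card V - 1) +
          ∑ u, ∑ v ∈ T.neighborFinset u, planarWeight T u v) : ℤ) : ℝ) := by
  set M := ∏ x, ((T.degree x)! : ℤ) with hM
  set c := (Fintype.card V : ℤ) ^ 2 + Fintype.card V - 1 with hc
  have h : 2 * ∑ π ∈ (planarArrangements T).toFinset, sumEdgeLengths T π =
      ((∑ u, ∑ v ∈ T.neighborFinset u, ∑ π ∈ (planarArrangements T).toFinset,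
        |((π u : ℕ) : ℤ) - (π v : ℕ)| : ℤ) : ℝ) := by
    rw [Finset.mul_sum, Finset.sum_congr rfl fun π _ => two_mul_sumEdgeLengths π,
      ← Int.cast_sum, Finset.sum_comm]
    congr 1
    exact Finset.sum_congr rfl fun u _ => Finset.sum_comm
  have h1 : ∀ u, ∀ v ∈ T.neighborFinset u, 3 * ∑ π ∈ (planarArrangements T).toFinset,
      |((π u : ℕ) : ℤ) - (π v : ℕ)| = M * (c + T.branchSize u v * T.branchSize v u -
        otherSquares T u v - otherSquares T v u) := by
    intro u v hv
    have huv := (T.mem_neighborFinset u v).1 hv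
    rw [hM, hc, ← sum_planarLists_gap hT huv]
    have h2 := sum_planarArrangements (T := T) u fun l => |(l.idxOf u : ℤ) - l.idxOf v|
    simp only [Arrangement.idxOf_toList] at h2
    rw [h2, Finset.sum_congr rfl fun l hl => sum_rotate_dist (mem_planarLists_univ.1 hl).1
      (mem_planarLists_univ.1 hl).2.1 (mem_planarLists_univ.1 hl).2.2.2 huv.ne, ← Finset.mul_sum]
    ring
  have h2 : 3 * ∑ u, ∑ v ∈ T.neighborFinset u, ∑ π ∈ (planarArrangements T).toFinset,
      |((π u : ℕ) : ℤ) - (π v : ℕ)| = M * (2 * ((Fintype.card V : ℤ) - 1) * c +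
        ∑ u, ∑ v ∈ T.neighborFinset u, planarWeight T u v) := by
    rw [Finset.mul_sum, Finset.sum_congr rfl fun u _ =>
      (Finset.mul_sum _ _ _).trans (Finset.sum_congr rfl (h1 u))]
    simp only [← Finset.mul_sum _ _ M, planarWeight, Finset.sum_sub_distrib, Finset.sum_add_distrib]
    rw [hT.sum_neighborFinset_const, sum_neighborFinset_comm (otherSquares T),
      sum_neighborFinset_comm fun u v => ((T.degree u : ℤ) - 1) * (T.branchSize u v : ℤ) ^ 2,
      sum_otherSquares]
    ring
  have h3 := congrArg (fun z : ℤ => (z : ℝ)) h2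
  rw [← h3]
  push_cast at h ⊢
  linear_combination 3 * h

/-- The conditional expectation in terms of degrees and sizes of branches. -/
theorem expSumLengthsCrossing_eq_div (hT : T.IsTree) :
    expSumLengthsCrossing T =
      (((((Fintype.card V)! : ℚ) * ((Fintype.card V : ℚ) ^ 2 - 1) / 3 -
        (∏ x, ((T.degree x)! : ℚ)) * (2 * ((Fintype.card V : ℚ) - 1) *
        ((Fintype.card V : ℚ) ^ 2 + Fintype.card V - 1) +
          ∑ u, ∑ v ∈ T.neighborFinset u, (planarWeight T u v : ℚ)) / 6) /
        (((Fintype.card V)! : ℚ) - Fintype.card V * ∏ x, ((T.degree x)! : ℚ)) : ℚ) : ℝ) := by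
  have h1 := sum_sumEdgeLengths hT
  have h2 := sum_sumEdgeLengths_planar hT
  rw [expSumLengthsCrossing_eq, numPlanar_eq hT]
  push_cast at h2 ⊢
  congr 1
  linear_combination (1 / 3) * h1 - (1 / 6) * h2

end Totals

/-! ### Programs with a time credit -/

namespace RAM

variable {S W : ℕ}

/-- Started in `σ` with a time credit `k`, the program halts in a state that satisfies `Q` together
with the remaining credit. -/
def Runs (S W : ℕ) (p : Prog) (k : ℕ) (σ : State) (Q : ℕ → State → Prop) : Prop :=
  ∃ t σ' k', Exec S W p σ t σ' ∧ t + k' ≤ k ∧ Q k' σ'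

theorem Runs.seq {p q : Prog} {k : ℕ} {σ : State} {Q R : ℕ → State → Prop}
    (hp : Runs S W p k σ Q) (hq : ∀ k σ, Q k σ → Runs S W q k σ R) :
    Runs S W (.seq p q) k σ R := by
  obtain ⟨t, σ', k', h, ht, hQ⟩ := hp
  obtain ⟨t', σ'', k'', h', ht', hR⟩ := hq k' σ' hQ
  exact ⟨t + t', σ'', k'', .seq h h', by omega, hR⟩

/-- Each successful test consumes a unit of credit, so induction on the credit gives termination.
The invariant is stated at `k' + 1` at the end because the failing test has also been paid for. -/
theorem Runs.loop {b : Test} {p : Prog} {I : ℕ → State → Prop}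
    (hI : ∀ k σ, I k σ → b.Holds σ → ∃ k', k = k' + 1 ∧ Runs S W p k' σ I)
    (h1 : ∀ k σ, I k σ → 1 ≤ k) {k : ℕ} {σ : State} (h : I k σ) :
    Runs S W (.loop b p) k σ fun k' σ' => ¬ b.Holds σ' ∧ I (k' + 1) σ' := by
  induction k using Nat.strong_induction_on generalizing σ with
  | _ k ih =>
    by_cases hb : b.Holds σ
    · obtain ⟨k₁, rfl, t, σ', k', hp, ht, hσ'⟩ := hI k σ h hb
      obtain ⟨t', σ'', k'', hl, ht', hQ⟩ := ih k' (by omega) hσ'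
      exact ⟨t + t' + 1, σ'', k'', .loop_true hb hp hl, by omega, hQ⟩
    · have := h1 k σ h
      exact ⟨1, σ, k - 1, .loop_false hb, by omega, hb, by rwa [Nat.sub_add_cancel this]⟩

/-- A straight-line program. -/
def block : List Instr → Prog
  | [] => .skip
  | c :: cs => .seq (.instr c) (block cs)

/-- All instructions of a straight-line program are legal, and it leads to a state with `Q`. -/
def BlockTo (S W : ℕ) (Q : State → Prop) : List Instr → State → Prop
  | [], σ => Q σ
  | c :: cs, σ => c.Legal S W σ ∧ BlockTo S W Q cs (c.apply σ)

theorem BlockTo.runs {Q : State → Prop} {cs : List Instr} {σ : State}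
    (h : BlockTo S W Q cs σ) {k : ℕ} (hk : cs.length ≤ k) :
    Runs S W (block cs) k σ fun k' σ' => k' = k - cs.length ∧ Q σ' := by
  induction cs generalizing k σ with
  | nil => exact ⟨0, σ, k, .skip σ, by omega, rfl, h⟩
  | cons c cs ih =>
    rw [List.length_cons] at hk
    obtain ⟨t, σ', k', he, ht, hk', hQ⟩ := ih h.2 (k := k - 1) (by omega)
    refine ⟨1 + t, σ', k', .seq (.instr c σ h.1) he, by omega, ?_, hQ⟩
    rw [List.length_cons]
    omega

theorem BlockTo.append {Q R : State → Prop} {cs cs' : List Instr} {σ : State}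
    (h : BlockTo S W Q cs σ) (h' : ∀ σ, Q σ → BlockTo S W R cs' σ) :
    BlockTo S W R (cs ++ cs') σ := by
  induction cs generalizing σ with
  | nil => exact h' σ h
  | cons c cs ih => exact ⟨h.1, ih h.2⟩

/-! ### Reading the edges -/

/-- The sum of `f b` over the pairs `(a, b)` in `D` with `a = z`. -/
def dartSum (f : ℕ → ℕ) (D : List (ℕ × ℕ)) (z : ℕ) : ℕ :=
  (D.map fun d => if d.1 = z then f d.2 else 0).sum

theorem dartSum_cons (f : ℕ → ℕ) (D : List (ℕ × ℕ)) (a b z : ℕ) :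
    dartSum f ((a, b) :: D) z = (if a = z then f b else 0) + dartSum f D z := by
  simp [dartSum]

theorem dartSum_le {f : ℕ → ℕ} {D : List (ℕ × ℕ)} {c : ℕ} (h : ∀ d ∈ D, f d.2 ≤ c) (z : ℕ) :
    dartSum f D z ≤ D.length * c := by
  refine (List.sum_le_card_nsmul _ c ?_).trans (by simp)
  intro x hx
  obtain ⟨d, hd, rfl⟩ := List.mem_map.1 hx
  split_ifs
  · exact h d hd
  · exact Nat.zero_le _

/-- Both orientations of the listed edges. -/
def bothDarts {n : ℕ} : List (Fin n × Fin n) → List (ℕ × ℕ)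
  | [] => []
  | e :: l => ((e.2 : ℕ), (e.1 : ℕ)) :: ((e.1 : ℕ), (e.2 : ℕ)) :: bothDarts l

theorem length_bothDarts {n : ℕ} (l : List (Fin n × Fin n)) :
    (bothDarts l).length = 2 * l.length := by
  induction l with
  | nil => rfl
  | cons e l ih =>
    rw [bothDarts, List.length_cons, List.length_cons, ih, List.length_cons]
    ring

theorem lt_of_mem_bothDarts {n : ℕ} {l : List (Fin n × Fin n)} {d : ℕ × ℕ}
    (h : d ∈ bothDarts l) : d.1 < n ∧ d.2 < n := by
  induction l with
  | nil => simp [bothDarts] at h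
  | cons e l ih =>
    rw [bothDarts, List.mem_cons, List.mem_cons] at h
    rcases h with rfl | rfl | h
    · exact ⟨e.2.2, e.1.2⟩
    · exact ⟨e.1.2, e.2.2⟩
    · exact ih h

/-- Recorded edges are put in front, so reading ends with the reversed input list. -/
theorem IsEdgeList.reverse {n : ℕ} {T : SimpleGraph (Fin n)} {l : List (Fin n × Fin n)}
    (h : IsEdgeList T l) : IsEdgeList T l.reverse := by
  rw [IsEdgeList, List.map_reverse, List.nodup_reverse]
  exact ⟨h.1, fun e => by rw [List.mem_reverse]; exact h.2 e⟩

theorem IsEdgeList.sum_map {n : ℕ} {T : SimpleGraph (Fin n)} [DecidableRel T.Adj]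
    {l : List (Fin n × Fin n)} (h : IsEdgeList T l) (F : Sym2 (Fin n) → ℕ) :
    (l.map fun e => F s(e.1, e.2)).sum = ∑ e ∈ T.edgeFinset, F e := by
  have h1 : (l.map fun e => s(e.1, e.2)).toFinset = T.edgeFinset := by
    ext e
    rw [List.mem_toFinset, h.2 e, SimpleGraph.mem_edgeFinset]
  rw [← h1, List.sum_toFinset _ h.1, List.map_map]
  rfl

theorem IsEdgeList.length_eq {n : ℕ} {T : SimpleGraph (Fin n)} {l : List (Fin n × Fin n)}
    (h : IsEdgeList T l) (hT : T.IsTree) : l.length + 1 = n := by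
  classical
  have h1 := h.sum_map fun _ => 1
  have h2 := hT.card_edgeFinset
  rw [Fintype.card_fin] at h2
  simp only [List.map_const', List.sum_replicate, Finset.sum_const, smul_eq_mul, mul_one] at h1
  omega

/-- For `f = 1` and `f = id` this identifies the stored words as degrees and sums of neighbours. -/
theorem IsEdgeList.dartSum_eq {n : ℕ} {T : SimpleGraph (Fin n)} [DecidableRel T.Adj]
    {l : List (Fin n × Fin n)} (h : IsEdgeList T l) (f : ℕ → ℕ) (z : Fin n) :
    dartSum f (bothDarts l) z = ∑ w ∈ T.neighborFinset z, f w := by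
  let F : Sym2 (Fin n) → ℕ := Sym2.lift ⟨fun a b => (if a = z then f b else 0) +
    if b = z then f a else 0, fun a b => add_comm _ _⟩
  have h1 : ∀ l : List (Fin n × Fin n),
      dartSum f (bothDarts l) z = (l.map fun e => F s(e.1, e.2)).sum := by
    intro l
    induction l with
    | nil => rfl
    | cons e l ih =>
      rw [bothDarts, dartSum_cons, dartSum_cons, ih, List.map_cons, List.sum_cons]
      simp only [F, Sym2.lift_mk, Fin.val_inj]
      ring
  rw [h1, h.sum_map]
  have h2 := sum_neighborFinset_eq (T := T) F
  simp only [F, Sym2.lift_mk, Finset.sum_add_distrib] at h2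
  have h3 : ∑ u, ∑ v ∈ T.neighborFinset u, (if u = z then f v else 0) =
      ∑ w ∈ T.neighborFinset z, f w := by
    rw [Finset.sum_eq_single z]
    · simp
    · intro u _ hu
      simp [hu]
    · simp
  have h4 := sum_neighborFinset_comm (T := T) fun u v : Fin n => if u = z then f v else 0
  rw [h3] at h4 h2
  rw [h4, smul_eq_mul] at h2
  simp only [F]
  omega

/-- Record that `word y` is a neighbour of `word x`. -/
def recordDart (x y : ℕ) : List Instr :=
  [.wordLoad 5 2 x, .wordAdd 5 5 1, .wordStore 2 x 5, .wordStore 5 x 5, .numOfWord 3 5,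
    .numMul 1 1 3, .wordLoad 5 3 x, .wordAdd 5 5 y, .wordStore 3 x 5]

/-- The memory while the edges are being read: `D` lists the darts recorded so far. -/
structure Reading (n : ℕ) (A B : ℕ → ℕ) (D : List (ℕ × ℕ)) (σ : State) : Prop where
  word_zero : σ.word 0 = n
  word_one : σ.word 1 = 1
  word_six : σ.word 6 = n - 1
  word_ten : σ.word 10 = 0
  fst_eq : σ.wordArr 0 = A
  snd_eq : σ.wordArr 1 = B
  current : ∀ z, σ.wordArr 2 z = dartSum (fun _ => 1) D z
  degree : ∀ z, σ.wordArr 5 z = dartSum (fun _ => 1) D z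
  nbr : ∀ z, σ.wordArr 3 z = dartSum id D z
  size : ∀ z, σ.wordArr 4 z = 0
  prod : σ.num 1 = ∏ z ∈ Finset.range n, ((dartSum (fun _ => 1) D z)! : ℚ)
  fact : σ.num 2 = 1
  acc : σ.num 4 = 0
  zero : σ.num 10 = 0

theorem Reading.recordDart {n : ℕ} {A B : ℕ → ℕ} {D : List (ℕ × ℕ)} {σ : State}
    (h : Reading n A B D σ) {x y a b : ℕ} (hx : σ.word x = a) (hy : σ.word y = b)
    (hx5 : x ≠ 5) (hy5 : y ≠ 5) (ha : a < n) (hS : n ≤ S)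
    (hd : dartSum (fun _ => 1) D a + 1 < W) (hn : dartSum id D a + b < W) :
    BlockTo S W (fun σ' => Reading n A B ((a, b) :: D) σ' ∧ ∀ z, z ≠ 5 → σ'.word z = σ.word z)
      (RAM.recordDart x y) σ := by
  have haS : a < S := by omega
  -- Raising a degree from `d` to `d + 1` multiplies the product of factorials by `d + 1`.
  have hp : ∏ z ∈ Finset.range n, ((dartSum (fun _ => 1) ((a, b) :: D) z)! : ℚ) =
      (∏ z ∈ Finset.range n, ((dartSum (fun _ => 1) D z)! : ℚ)) *
        ((dartSum (fun _ => 1) D a + 1 : ℕ) : ℚ) := by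
    rw [← Finset.mul_prod_erase _ _ (Finset.mem_range.2 ha),
      ← Finset.mul_prod_erase _ (fun z => ((dartSum (fun _ => 1) D z)! : ℚ))
        (Finset.mem_range.2 ha), dartSum_cons, if_pos rfl, add_comm 1, Nat.factorial_succ,
      Finset.prod_congr rfl fun z hz => by
        rw [dartSum_cons, if_neg (Finset.ne_of_mem_erase hz).symm, zero_add]]
    push_cast
    ring
  simp [RAM.recordDart, BlockTo, Instr.Legal, Instr.apply, Function.update_apply, hx, hy, hx5, hy5,
    h.word_one, h.current, h.nbr, haS, hd, hn]
  refine ⟨⟨?_, ?_, ?_, ?_, ?_, ?_, ?_, ?_, ?_, ?_, ?_, ?_, ?_, ?_⟩, ?_⟩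
  · exact h.word_zero
  · exact h.word_one
  · exact h.word_six
  · exact h.word_ten
  · exact h.fst_eq
  · exact h.snd_eq
  · intro z
    rw [dartSum_cons]
    by_cases hz : z = a
    · subst hz
      simp [add_comm]
    · simp [h.current, hz, Ne.symm hz]
  · intro z
    rw [dartSum_cons]
    by_cases hz : z = a
    · subst hz
      simp [add_comm]
    · simp [h.degree, hz, Ne.symm hz]
  · intro z
    rw [dartSum_cons]
    by_cases hz : z = a
    · subst hz
      simp [add_comm]
    · simp [h.nbr, hz, Ne.symm hz]
  · exact h.size
  · rw [hp, h.prod.symm]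
    simp
  · exact h.fact
  · exact h.acc
  · exact h.zero
  · intro z hz
    simp [hz]

end RAM

/-! ### The loop that reads the edges -/

namespace RAM

variable {S W : ℕ}

/-- Set the constant one and the products to one. -/
def initBlock : List Instr := [.wordConst 1 1, .wordSub 6 0 1, .numOfWord 1 1, .numOfWord 2 1]

/-- Read an edge and record both of its darts. -/
def readBlock : List Instr :=
  [.wordLoad 3 0 2, .wordLoad 4 1 2] ++ (recordDart 3 4 ++ (recordDart 4 3 ++ [.wordAdd 2 2 1]))

/-- Compute the degrees, the sums of the neighbours and the product of the factorials of the
degrees. -/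
def readProg : Prog := .seq (block initBlock) (.loop (.wordLt 2 6) (block readBlock))

/-- The first end points of the listed edges, as stored in memory. -/
def fstArr {n : ℕ} (l : List (Fin n × Fin n)) (i : ℕ) : ℕ := (l.map fun e => (e.1 : ℕ)).getD i 0

/-- The second end points of the listed edges, as stored in memory. -/
def sndArr {n : ℕ} (l : List (Fin n × Fin n)) (i : ℕ) : ℕ := (l.map fun e => (e.2 : ℕ)).getD i 0

theorem initBlock_to {n : ℕ} (l : List (Fin n × Fin n)) (hW : 1 < W) :
    BlockTo S W (fun σ => Reading n (fstArr l) (sndArr l) [] σ ∧ σ.word 2 = 0) initBlock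
      (input l) := by
  simp [initBlock, BlockTo, Instr.Legal, Instr.apply, input, hW]
  refine ⟨?_, ?_, ?_, ?_, ?_, ?_, ?_, ?_, ?_, ?_, ?_, ?_, ?_, ?_⟩
  any_goals simp [dartSum]
  · ext i
    simp [fstArr]
  · ext i
    simp [sndArr]

theorem readBlock_to {n : ℕ} {l : List (Fin n × Fin n)} (hl : l.length + 1 = n) (hS : n ≤ S)
    (hW : ∀ m ≤ 2 * n * n + 2 * n + 3, m < W) {i : ℕ} (hi : i < l.length) {σ : State}
    (h2 : σ.word 2 = i)
    (h : Reading n (fstArr l) (sndArr l) (bothDarts (l.take i).reverse) σ) :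
    BlockTo S W (fun σ => Reading n (fstArr l) (sndArr l) (bothDarts (l.take (i + 1)).reverse) σ ∧
      σ.word 2 = i + 1) readBlock σ := by
  have hd : ∀ z, dartSum (fun _ => 1) (bothDarts (l.take i).reverse) z ≤ 2 * i := by
    intro z
    refine (dartSum_le (c := 1) (fun _ _ => le_rfl) z).trans ?_
    rw [length_bothDarts, List.length_reverse, List.length_take]
    omega
  have hn : ∀ z, dartSum id (bothDarts (l.take i).reverse) z ≤ 2 * i * n := by
    intro z
    refine (dartSum_le (c := n) (fun d hd => (lt_of_mem_bothDarts hd).2.le) z).trans ?_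
    refine Nat.mul_le_mul_right n ?_
    rw [length_bothDarts, List.length_reverse, List.length_take]
    omega
  have hin : 2 * i * n + 2 * n ≤ 2 * n * n := by nlinarith
  have h1 := l[i].1.2
  have h2' := l[i].2.2
  have htake : (l.take (i + 1)).reverse = l[i] :: (l.take i).reverse := by
    rw [List.take_succ_eq_append_getElem hi]
    simp
  refine BlockTo.append (Q := fun σ => Reading n (fstArr l) (sndArr l)
    (bothDarts (l.take i).reverse) σ ∧ σ.word 2 = i ∧ σ.word 3 = (l[i].1 : ℕ) ∧
      σ.word 4 = (l[i].2 : ℕ)) ?_ ?_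
  · have e1 : fstArr l i = (l[i].1 : ℕ) := by simp [fstArr, hi]
    have e2 : sndArr l i = (l[i].2 : ℕ) := by simp [sndArr, hi]
    have hiS : i < S := by omega
    simp [BlockTo, Instr.Legal, Instr.apply, h2, h.fst_eq, h.snd_eq, e1, e2, hiS]
    exact ⟨h.word_zero, h.word_one, h.word_six, h.word_ten, h.fst_eq, h.snd_eq, h.current,
      h.degree, h.nbr, h.size, h.prod, h.fact, h.acc, h.zero⟩
  rintro σ ⟨h, h2, h3, h4⟩
  refine BlockTo.append (h.recordDart h3 h4 (by decide) (by decide) h1 hS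
    (hW _ (by have := hd l[i].1; omega)) (hW _ (by have := hn l[i].1; omega))) ?_
  rintro σ' ⟨h', hw⟩
  refine BlockTo.append (h'.recordDart ((hw 4 (by decide)).trans h4) ((hw 3 (by decide)).trans h3)
    (by decide) (by decide) h2' hS (hW _ ?_) (hW _ ?_)) ?_
  · rw [dartSum_cons]
    have := hd l[i].2
    split_ifs <;> omega
  · rw [dartSum_cons]
    have := hn l[i].2
    simp only [id]
    split_ifs <;> omega
  rintro σ'' ⟨h'', hw'⟩
  have h2'' : σ''.word 2 = i := by rw [hw' 2 (by decide), hw 2 (by decide), h2]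
  have hi1 : i + 1 < W := hW _ (by omega)
  rw [htake, bothDarts]
  simp [BlockTo, Instr.Legal, Instr.apply, h2'', h''.word_one, hi1]
  exact ⟨h''.word_zero, h''.word_one, h''.word_six, h''.word_ten, h''.fst_eq, h''.snd_eq,
    h''.current, h''.degree, h''.nbr, h''.size, h''.prod, h''.fact, h''.acc, h''.zero⟩

theorem readProg_runs {n : ℕ} {l : List (Fin n × Fin n)} (hl : l.length + 1 = n) (hS : n ≤ S)
    (hW : ∀ m ≤ 2 * n * n + 2 * n + 3, m < W) {k : ℕ} (hk : 22 * n ≤ k) :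
    Runs S W readProg k (input l) fun k' σ => k ≤ k' + 22 * n ∧
      Reading n (fstArr l) (sndArr l) (bothDarts l.reverse) σ := by
  refine Runs.seq ((initBlock_to l (hW 1 (by omega))).runs (by simp [initBlock]; omega)) ?_
  rintro k₁ σ ⟨rfl, h, h2⟩
  -- An edge costs 22 steps: the 21 instructions of `readBlock` and the test.
  let I : ℕ → State → Prop := fun j σ => ∃ i ≤ l.length,
    Reading n (fstArr l) (sndArr l) (bothDarts (l.take i).reverse) σ ∧ σ.word 2 = i ∧
      22 * (l.length - i) + k ≤ j + 22 * n - 1 ∧ 1 ≤ j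
  have hI : I (k - initBlock.length) σ := by
    refine ⟨0, Nat.zero_le _, by simpa [bothDarts] using h, h2, ?_, ?_⟩ <;>
    simp only [initBlock, List.length_cons, List.length_nil] <;> omega
  have hloop := Runs.loop (S := S) (W := W) (b := .wordLt 2 6) (p := block readBlock) (I := I)
    ?_ (fun k σ h => h.choose_spec.2.2.2.2) hI
  · obtain ⟨t, σ', k', he, ht, hb, i, hi, hr, h2, hk', -⟩ := hloop
    refine ⟨t, σ', k', he, ht, by omega, ?_⟩
    have : ¬ σ'.word 2 < σ'.word 6 := hb
    rw [h2, hr.word_six] at this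
    obtain rfl : i = l.length := by omega
    rwa [List.take_length] at hr
  · rintro j σ ⟨i, hi, hr, h2, hj, hj1⟩ hb
    have hb : σ.word 2 < σ.word 6 := hb
    rw [h2, hr.word_six] at hb
    have hil : i < l.length := by omega
    have hlen : readBlock.length = 21 := rfl
    refine ⟨j - 1, by omega, ?_⟩
    obtain ⟨t, σ', k', he, ht, hk', hr', h2'⟩ :=
      (readBlock_to hl hS hW hil h2 hr).runs (k := j - 1) (by omega)
    exact ⟨t, σ', k', he, ht, i + 1, hil, hr', h2', by omega, by omega⟩

end RAM

/-! ### Removing leaves -/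

section DeleteEdge

variable {V : Type*} [Fintype V]

theorem SimpleGraph.sum_neighborFinset_deleteEdge [DecidableEq V] {M : Type*} [AddCommMonoid M]
    {R R' : SimpleGraph V} [DecidableRel R.Adj] [DecidableRel R'.Adj] {v u : V}
    (hR' : R' = R.deleteEdges {s(v, u)}) (h : R.Adj v u) (f : V → M) (x : V) :
    ∑ y ∈ R.neighborFinset x, f y = ∑ y ∈ R'.neighborFinset x, f y +
      ((if x = v then f u else 0) + if x = u then f v else 0) := by
  have h1 : R'.neighborFinset x = (R.neighborFinset x).filter fun y => ¬ s(x, y) = s(v, u) := by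
    ext y
    simp [hR', SimpleGraph.deleteEdges_adj]
  rw [h1, ← Finset.sum_filter_add_sum_filter_not (R.neighborFinset x) fun y => s(x, y) = s(v, u),
    add_comm]
  congr 1
  by_cases hv : x = v
  · subst hv
    have h2 : (R.neighborFinset x).filter (fun y => s(x, y) = s(x, u)) = {u} := by
      ext y
      simp only [Finset.mem_filter, SimpleGraph.mem_neighborFinset, Finset.mem_singleton,
        Sym2.congr_right]
      exact ⟨fun h => h.2, fun h' => ⟨h' ▸ h, h'⟩⟩
    rw [h2, Finset.sum_singleton, if_pos rfl, if_neg h.ne, add_zero]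
  by_cases hu : x = u
  · subst hu
    have h2 : (R.neighborFinset x).filter (fun y => s(x, y) = s(v, x)) = {v} := by
      ext y
      simp only [Finset.mem_filter, SimpleGraph.mem_neighborFinset, Finset.mem_singleton,
        Sym2.eq_swap (a := v), Sym2.congr_right]
      exact ⟨fun h => h.2, fun h' => ⟨h' ▸ h.symm, h'⟩⟩
    rw [h2, Finset.sum_singleton, if_neg hv, if_pos rfl, zero_add]
  · rw [if_neg hv, if_neg hu, add_zero]
    refine Finset.sum_eq_zero fun y hy => ?_
    have := (Finset.mem_filter.1 hy).2
    rw [Sym2.eq_iff] at this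
    tauto

theorem SimpleGraph.degree_deleteEdge [DecidableEq V] {R R' : SimpleGraph V}
    [DecidableRel R.Adj] [DecidableRel R'.Adj] {v u : V} (hR' : R' = R.deleteEdges {s(v, u)})
    (h : R.Adj v u) (x : V) :
    R.degree x = R'.degree x + ((if x = v then 1 else 0) + if x = u then 1 else 0) := by
  have := SimpleGraph.sum_neighborFinset_deleteEdge hR' h (fun _ => 1) x
  rwa [← Finset.card_eq_sum_ones, ← Finset.card_eq_sum_ones,
    SimpleGraph.card_neighborFinset_eq_degree, SimpleGraph.card_neighborFinset_eq_degree] at this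

/-- A subgraph of a tree without vertices of degree one has no edges. -/
theorem SimpleGraph.IsTree.eq_bot_of_degree_ne_one [DecidableEq V] {T R : SimpleGraph V}
    [DecidableRel R.Adj] (hT : T.IsTree) (hR : R ≤ T) (h : ∀ x, R.degree x ≠ 1) : R = ⊥ := by
  classical
  by_contra hne
  obtain ⟨a, b, hab⟩ := SimpleGraph.ne_bot_iff_exists_adj.1 hne
  -- Take an oriented edge of `R` with the fewest vertices of `T` on the side of `v`. A second
  -- neighbour `c` of `v` in `R` would have a strictly smaller side.
  obtain ⟨⟨v, u⟩, hvu, hmin⟩ := Finset.exists_min_image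
    (Finset.univ.filter fun q : V × V => R.Adj q.1 q.2) (fun q => T.branchSize q.2 q.1)
    ⟨(a, b), by simpa using hab⟩
  simp only [Finset.mem_filter, Finset.mem_univ, true_and] at hvu hmin
  refine h v ?_
  rw [← SimpleGraph.card_neighborFinset_eq_degree, Finset.card_eq_one]
  refine ⟨u, Finset.eq_singleton_iff_unique_mem.2 ⟨by simpa using hvu, fun c hc => ?_⟩⟩
  by_contra hcu
  rw [SimpleGraph.mem_neighborFinset] at hc
  have h1 := hT.sum_branchSize v
  have h2 := hT.branchSize_add (hR hvu)
  have h3 : T.branchSize v u + T.branchSize v c ≤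
      ∑ q ∈ T.neighborFinset v, T.branchSize v q := by
    rw [← Finset.sum_pair (Ne.symm hcu)]
    refine Finset.sum_le_sum_of_subset fun x hx => ?_
    rw [Finset.mem_insert, Finset.mem_singleton] at hx
    rw [SimpleGraph.mem_neighborFinset]
    rcases hx with rfl | rfl
    · exact hR hvu
    · exact hR hc
  have h4 := hmin (c, v) hc.symm
  dsimp only at h4
  omega

end DeleteEdge

/-! ### The loops that remove leaves -/

namespace RAM

variable {S W n : ℕ}

open scoped Classical in
/-- The memory while leaves are being removed: `R` is what remains of the tree `T`. -/
structure Peeling (T R : SimpleGraph (Fin n)) (σ : State) : Prop where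
  le : R ≤ T
  word_zero : σ.word 0 = n
  word_one : σ.word 1 = 1
  word_ten : σ.word 10 = 0
  current : ∀ z : Fin n, σ.wordArr 2 z = R.degree z
  degree : ∀ z : Fin n, σ.wordArr 5 z = T.degree z
  nbr : ∀ z : Fin n, σ.wordArr 3 z = ∑ w ∈ R.neighborFinset z, (w : ℕ)
  size : ∀ z : Fin n, R.degree z ≠ 0 →
    σ.wordArr 4 z + ∑ w ∈ R.neighborFinset z, T.branchSize z w + 1 = n
  prod : σ.num 1 = ∏ x, ((T.degree x)! : ℚ)
  acc : 2 * σ.num 4 + ∑ u, ∑ v ∈ R.neighborFinset u, (planarWeight T u v : ℚ) =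
    ∑ u, ∑ v ∈ T.neighborFinset u, (planarWeight T u v : ℚ)
  zero : σ.num 10 = 0

/-- Remove the leaf `word 7` and move on to its neighbour. -/
def peelBlock : List Instr :=
  [.wordLoad 8 3 7, .wordStore 2 7 10, .wordStore 3 7 10,
    .wordLoad 5 3 8, .wordSub 5 5 7, .wordStore 3 8 5,
    .wordLoad 11 4 7, .wordAdd 11 11 1, .wordLoad 5 4 8, .wordAdd 5 5 11, .wordStore 4 8 5,
    .numOfWord 5 11, .numOfWord 6 0, .numSub 6 6 5, .numMul 7 5 6, .numAdd 4 4 7,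
    .wordLoad 5 5 8, .wordSub 5 5 1, .numOfWord 7 5, .numMul 7 7 5, .numMul 7 7 5, .numSub 4 4 7,
    .wordLoad 5 5 7, .wordSub 5 5 1, .numOfWord 7 5, .numMul 7 7 6, .numMul 7 7 6, .numSub 4 4 7,
    .wordLoad 9 2 8, .wordSub 9 9 1, .wordStore 2 8 9, .wordAdd 7 8 10,
    .wordSub 5 9 1, .wordSub 9 1 9, .wordAdd 9 9 5]

open scoped Classical in
/-- `word 7` is the vertex that is looked at, and `word 9` vanishes if it is a leaf. -/
def Looking (R : SimpleGraph (Fin n)) (c : Fin n) (σ : State) : Prop :=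
  σ.word 7 = c ∧ σ.word 9 = (1 - R.degree c) + (R.degree c - 1)

theorem planarWeight_comm (T : SimpleGraph (Fin n)) [DecidableRel T.Adj] (u v : Fin n) :
    planarWeight T u v = planarWeight T v u := by
  rw [planarWeight, planarWeight]
  ring

open scoped Classical in
-- At a leaf `v` of `R` the stored sum of neighbours is its neighbour `u`. Array 4 counts the
-- vertices already removed behind a vertex, so the entry of `v` plus one is `T.branchSize u v`, and
-- `n` minus this is the opposite size. The entry of `v` is not updated, so the invariant `size`
-- speaks only of vertices that still have an edge. The weight is added once per edge, whence the
-- factor 2 in `acc`.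
theorem peelBlock_to {T R R' : SimpleGraph (Fin n)} (hT : T.IsTree) (hS : n ≤ S)
    (hW : ∀ m ≤ 2 * n * n + 2 * n + 3, m < W) {σ : State} (h : Peeling T R σ) {v u : Fin n}
    (hv : σ.word 7 = v) (hd : R.degree v = 1) (hvu : R.Adj v u)
    (hR' : R' = R.deleteEdges {s(v, u)}) :
    BlockTo S W (fun σ' => Peeling T R' σ' ∧ Looking R' u σ' ∧ σ'.word 2 = σ.word 2 ∧
      σ'.num 2 = σ.num 2) peelBlock σ := by
  have hne : (u : ℕ) ≠ v := fun h => hvu.ne (Fin.ext h).symm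
  have hN : R.neighborFinset v = {u} := by
    obtain ⟨w, hw⟩ := Finset.card_eq_one.1 hd
    rw [hw, Finset.singleton_inj]
    have : u ∈ R.neighborFinset v := by simpa using hvu
    rw [hw, Finset.mem_singleton] at this
    exact this.symm
  have hnv : σ.wordArr 3 v = u := by rw [h.nbr, hN, Finset.sum_singleton]
  have hTvu := h.le hvu
  have hab := hT.branchSize_add hTvu
  rw [Fintype.card_fin] at hab
  have hsv : σ.wordArr 4 v + 1 = T.branchSize u v := by
    have := h.size v (by omega)
    rw [hN, Finset.sum_singleton] at this
    omega
  have hdu : R.degree u ≠ 0 := by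
    have := SimpleGraph.degree_deleteEdge hR' hvu u
    rw [if_pos rfl] at this
    omega
  have hsu := h.size u hdu
  have hsum := fun f : Fin n → ℕ => SimpleGraph.sum_neighborFinset_deleteEdge hR' hvu f
  have hsu' : σ.wordArr 4 u + T.branchSize u v +
      ∑ w ∈ R'.neighborFinset u, T.branchSize u w + 1 = n := by
    have := hsum (T.branchSize u) u
    rw [if_neg hvu.ne', if_pos rfl] at this
    omega
  have hdeg := fun x => SimpleGraph.degree_deleteEdge hR' hvu x
  have hdlt : R.degree u < n := by
    have := R.degree_lt_card_verts u
    rwa [Fintype.card_fin] at this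
  have b1 : T.branchSize u v < W := hW _ (by omega)
  have b2 : σ.wordArr 4 u + T.branchSize u v < W := hW _ (by omega)
  have b3 : 1 - (R.degree u - 1) + (R.degree u - 1 - 1) < W := hW _ (by omega)
  have b4 : (u : ℕ) < W := hW _ (by omega)
  have hvS : (v : ℕ) < S := by omega
  have huS : (u : ℕ) < S := by omega
  simp [peelBlock, BlockTo, Instr.Legal, Instr.apply, hv, hnv, hsv,
    hvS, huS, h.word_zero, h.word_one, h.word_ten, h.current, h.degree, hne,
    b1, b2, b3, b4]
  refine ⟨⟨?_, ?_, ?_, ?_, ?_, ?_, ?_, ?_, ?_, ?_, ?_⟩, ?_, ?_⟩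
  · rw [hR']
    exact (R.deleteEdges_le _).trans h.le
  · exact h.word_zero
  · exact h.word_one
  · exact h.word_ten
  · intro z
    have := hdeg z
    rcases eq_or_ne z u with rfl | hzu
    · rw [if_neg hvu.ne', if_pos rfl] at this
      simp
      omega
    · have hzu' : (z : ℕ) ≠ u := fun h => hzu (Fin.ext h)
      rcases eq_or_ne z v with rfl | hzv
      · rw [if_pos rfl] at this
        simp [hzu']
        omega
      · have hzv' : (z : ℕ) ≠ v := fun h => hzv (Fin.ext h)
        rw [if_neg hzv, if_neg hzu] at this
        simp [hzu', hzv', h.current, this]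
  · exact h.degree
  · intro z
    have := hsum (fun w => (w : ℕ)) z
    rcases eq_or_ne z u with rfl | hzu
    · rw [if_neg hvu.ne', if_pos rfl, ← h.nbr] at this
      simp
      omega
    · have hzu' : (z : ℕ) ≠ u := fun h => hzu (Fin.ext h)
      rcases eq_or_ne z v with rfl | hzv
      · rw [if_pos rfl, if_neg hzu, hN, Finset.sum_singleton] at this
        simp [hzu']
        omega
      · have hzv' : (z : ℕ) ≠ v := fun h => hzv (Fin.ext h)
        rw [if_neg hzv, if_neg hzu, ← h.nbr] at this
        simp [hzu', hzv', this]
  · intro z hz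
    have := hsum (T.branchSize z) z
    rcases eq_or_ne z u with rfl | hzu
    · simpa using hsu'
    · have hzu' : (z : ℕ) ≠ u := fun h => hzu (Fin.ext h)
      rcases eq_or_ne z v with rfl | hzv
      · have := hdeg z
        rw [if_pos rfl] at this
        omega
      · rw [if_neg hzv, if_neg hzu] at this
        have h0 := hdeg z
        rw [if_neg hzv, if_neg hzu] at h0
        have := h.size z (by omega)
        simp [hzu']
        omega
  · exact h.prod
  · have h1 : ∑ x, ∑ y ∈ R.neighborFinset x, (planarWeight T x y : ℚ) =
        ∑ x, ∑ y ∈ R'.neighborFinset x, (planarWeight T x y : ℚ) + 2 * planarWeight T v u := by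
      rw [Finset.sum_congr rfl fun x _ => SimpleGraph.sum_neighborFinset_deleteEdge hR' hvu
        (fun y => (planarWeight T x y : ℚ)) x, Finset.sum_add_distrib, Finset.sum_add_distrib]
      simp [planarWeight_comm T u v, two_mul]
    rw [← h.acc, h1]
    have hdv1 : 1 ≤ T.degree v := (T.degree_pos_iff_exists_adj v).2 ⟨u, hTvu⟩
    have hdu1 : 1 ≤ T.degree u := (T.degree_pos_iff_exists_adj u).2 ⟨v, hTvu.symm⟩
    have h2 : (planarWeight T v u : ℚ) = T.branchSize v u * T.branchSize u v -
        ((T.degree v : ℚ) - 1) * (T.branchSize v u : ℚ) ^ 2 -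
        ((T.degree u : ℚ) - 1) * (T.branchSize u v : ℚ) ^ 2 := by
      simp [planarWeight]
    rw [h2]
    simp [Nat.cast_sub hdv1, Nat.cast_sub hdu1, ← hab]
    ring
  · exact h.zero
  · have := hdeg u
    rw [if_neg hvu.ne', if_pos rfl] at this
    simp
  · have := hdeg u
    rw [if_neg hvu.ne', if_pos rfl] at this
    simp
    omega

/-- Look at the vertex `word 2`. -/
def lookBlock : List Instr :=
  [.wordAdd 7 2 10, .wordLoad 9 2 7, .wordSub 5 9 1, .wordSub 9 1 9, .wordAdd 9 9 5,
    .wordAdd 2 2 1, .numOfWord 3 2, .numMul 2 2 3]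

open scoped Classical in
-- Looking changes nothing in the tree; the scan also multiplies its successive counter values,
-- which yields `n!`.
theorem lookBlock_to {T R : SimpleGraph (Fin n)} (hS : n ≤ S)
    (hW : ∀ m ≤ 2 * n * n + 2 * n + 3, m < W) {σ : State} (h : Peeling T R σ) {i : ℕ}
    (hi : i < n) (h2 : σ.word 2 = i) :
    BlockTo S W (fun σ' => Peeling T R σ' ∧ Looking R ⟨i, hi⟩ σ' ∧ σ'.word 2 = i + 1 ∧
      σ'.num 2 = σ.num 2 * (i + 1 : ℕ)) lookBlock σ := by
  have hc := h.current ⟨i, hi⟩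
  dsimp only at hc
  have hdlt : R.degree ⟨i, hi⟩ < n := by
    have := R.degree_lt_card_verts ⟨i, hi⟩
    rwa [Fintype.card_fin] at this
  have b1 : i + 1 < W := hW _ (by omega)
  have b2 : i < W := by omega
  have b3 : 1 - R.degree ⟨i, hi⟩ + (R.degree ⟨i, hi⟩ - 1) < W := hW _ (by omega)
  have hiS : i < S := by omega
  simp [lookBlock, BlockTo, Instr.Legal, Instr.apply, h2, h.word_one, h.word_ten, hc, b1, b2, b3,
    hiS, Looking]
  exact ⟨h.le, h.word_zero, h.word_one, h.word_ten, h.current, h.degree, h.nbr, h.size, h.prod,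
    h.acc, h.zero⟩

/-- Remove leaves, starting from `word 7`, as long as this is possible. -/
def peelLoop : Prog := .loop (.wordLt 9 1) (block peelBlock)

/-- Remove all edges, leaf by leaf. -/
def peelProg : Prog := .loop (.wordLt 2 0) (.seq (block lookBlock) peelLoop)

open scoped Classical in
-- Removing the edge `vu` isolates the leaf `v` and otherwise changes only the degree of `u`, so `u`
-- is the only possible new leaf below `i`. An edge carries two units of the degree sum, that is 40
-- steps, enough for the 35 instructions of `peelBlock` and a test.
theorem peelLoop_runs {T R : SimpleGraph (Fin n)} (hT : T.IsTree) (hS : n ≤ S)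
    (hW : ∀ m ≤ 2 * n * n + 2 * n + 3, m < W) {σ : State} (h : Peeling T R σ) {v : Fin n}
    (hv : Looking R v σ) {i : ℕ} (hi : ∀ z : Fin n, z < i → z ≠ v → R.degree z ≠ 1) {k C : ℕ}
    (hk : 20 * ∑ z, R.degree z + C + 1 ≤ k) :
    Runs S W peelLoop k σ fun k' σ' => ∃ R' : SimpleGraph (Fin n), Peeling T R' σ' ∧
      (∀ z : Fin n, z < i → R'.degree z ≠ 1) ∧ σ'.word 2 = σ.word 2 ∧ σ'.num 2 = σ.num 2 ∧
      20 * ∑ z, R'.degree z + C ≤ k' := by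
  let I : ℕ → State → Prop := fun k' σ' => ∃ (R' : SimpleGraph (Fin n)) (v : Fin n),
    Peeling T R' σ' ∧ Looking R' v σ' ∧ (∀ z : Fin n, z < i → z ≠ v → R'.degree z ≠ 1) ∧
    σ'.word 2 = σ.word 2 ∧ σ'.num 2 = σ.num 2 ∧ 20 * ∑ z, R'.degree z + C + 1 ≤ k'
  have hloop := Runs.loop (S := S) (W := W) (b := .wordLt 9 1) (p := block peelBlock) (I := I)
    ?_ (fun k σ h => ?_) (k := k) (σ := σ) ⟨R, v, h, hv, hi, rfl, rfl, hk⟩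
  · obtain ⟨t, σ', k', he, ht, hb, R', v', hp, hl, hz, h2, hf, hk'⟩ := hloop
    refine ⟨t, σ', k', he, ht, R', hp, fun z hzi => ?_, h2, hf, by omega⟩
    rcases eq_or_ne z v' with rfl | hne
    -- With truncated subtraction, `(1 - d) + (d - 1)` vanishes only for `d = 1`.
    · have hb : ¬ σ'.word 9 < σ'.word 1 := hb
      rw [hl.2, hp.word_one] at hb
      omega
    · exact hz z hzi hne
  · rintro j σ' ⟨R', v', hp, hl, hz, h2, hf, hj⟩ hb
    have hb : σ'.word 9 < σ'.word 1 := hb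
    rw [hl.2, hp.word_one] at hb
    have hd : R'.degree v' = 1 := by omega
    obtain ⟨u, hu⟩ := (R'.degree_pos_iff_exists_adj v').1 (by omega)
    obtain ⟨R'', hR''⟩ : ∃ R'', R'' = R'.deleteEdges {s(v', u)} := ⟨_, rfl⟩
    have hdeg := fun x => SimpleGraph.degree_deleteEdge hR'' hu x
    have hsum : ∑ z, R'.degree z = ∑ z, R''.degree z + 2 := by
      rw [Finset.sum_congr rfl fun x _ => hdeg x, Finset.sum_add_distrib, Finset.sum_add_distrib]
      simp
    have hlen : peelBlock.length = 35 := rfl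
    refine ⟨j - 1, by omega, ?_⟩
    obtain ⟨t, σ'', k', he, ht, hk', hp', hl', h2', hf'⟩ :=
      (peelBlock_to hT hS hW hp hl.1 hd hu hR'').runs (k := j - 1) (by omega)
    refine ⟨t, σ'', k', he, ht, R'', u, hp', hl', fun z hzi hzu => ?_, h2'.trans h2, hf'.trans hf,
      ?_⟩
    · have := hdeg z
      rw [if_neg hzu] at this
      rcases eq_or_ne z v' with rfl | hzv
      · rw [if_pos rfl] at this
        omega
      · rw [if_neg hzv] at this
        have := hz z hzi hzv
        omega
    · omega
  · obtain ⟨R', v, h⟩ := h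
    omega

open scoped Classical in
-- After the scan no vertex is a leaf, so no edge is left. The 12 steps per vertex cover the eight
-- instructions of `lookBlock`, the outer test and the failing inner test.
theorem peelProg_runs {T : SimpleGraph (Fin n)} (hT : T.IsTree) (hS : n ≤ S)
    (hW : ∀ m ≤ 2 * n * n + 2 * n + 3, m < W) {σ : State} (h : Peeling T T σ)
    (h2 : σ.word 2 = 0) (hf : σ.num 2 = 1) {k C : ℕ}
    (hk : 20 * ∑ z, T.degree z + 12 * n + C + 1 ≤ k) :
    Runs S W peelProg k σ fun k' σ' => Peeling T ⊥ σ' ∧ σ'.num 2 = (n ! : ℚ) ∧ C ≤ k' := by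
  let I : ℕ → State → Prop := fun k' σ' => ∃ (R : SimpleGraph (Fin n)) (i : ℕ), i ≤ n ∧
    Peeling T R σ' ∧ (∀ z : Fin n, z < i → R.degree z ≠ 1) ∧ σ'.word 2 = i ∧
    σ'.num 2 = (i ! : ℚ) ∧ 20 * ∑ z, R.degree z + 12 * (n - i) + C + 1 ≤ k'
  have hloop := Runs.loop (S := S) (W := W) (b := .wordLt 2 0)
    (p := .seq (block lookBlock) peelLoop) (I := I) ?_ (fun k σ h => ?_) (k := k) (σ := σ)
    ⟨T, 0, Nat.zero_le n, h, by simp, h2, by simpa using hf, hk⟩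
  · obtain ⟨t, σ', k', he, ht, hb, R, i, hi, hp, hz, h2, hf, hk'⟩ := hloop
    have hb : ¬ σ'.word 2 < σ'.word 0 := hb
    rw [h2, hp.word_zero] at hb
    obtain rfl : i = n := by omega
    obtain rfl := hT.eq_bot_of_degree_ne_one hp.le fun z => hz z z.2
    exact ⟨t, σ', k', he, ht, hp, hf, by omega⟩
  · rintro j σ' ⟨R, i, hi, hp, hz, h2, hf, hj⟩ hb
    have hb : σ'.word 2 < σ'.word 0 := hb
    rw [h2, hp.word_zero] at hb
    have hlen : lookBlock.length = 8 := rfl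
    refine ⟨j - 1, by omega, ?_⟩
    refine Runs.seq ((lookBlock_to hS hW hp hb h2).runs (k := j - 1) (by omega)) ?_
    rintro k₁ σ₁ ⟨hk₁, hp₁, hl₁, h2₁, hf₁⟩
    obtain ⟨t, σ'', k', he, ht, R', hp', hz', h2', hf', hk'⟩ :=
      peelLoop_runs hT hS hW hp₁ hl₁ (i := i + 1) (k := k₁) (C := 12 * (n - (i + 1)) + C + 1)
        (fun z hzi hne => hz z (by
          have : (z : ℕ) ≠ i := fun h => hne (Fin.ext h)
          omega)) (by omega)
    refine ⟨t, σ'', k', he, ht, R', i + 1, hb, hp', hz', h2'.trans h2₁, ?_, by omega⟩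
    rw [hf', hf₁, hf, Nat.factorial_succ]
    push_cast
    ring
  · obtain ⟨R, i, h⟩ := h
    omega

end RAM

/-! ### The whole program -/

namespace RAM

variable {S W n : ℕ}

open scoped Classical in
theorem Reading.peeling {T : SimpleGraph (Fin n)} (hT : T.IsTree) {l : List (Fin n × Fin n)}
    (hl : IsEdgeList T l) {A B : ℕ → ℕ} {σ : State}
    (h : Reading n A B (bothDarts l.reverse) σ) : Peeling T T σ := by
  have hdeg : ∀ z : Fin n, dartSum (fun _ => 1) (bothDarts l.reverse) z = T.degree z := fun z => by
    rw [hl.reverse.dartSum_eq]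
    simp
  refine ⟨le_rfl, h.word_zero, h.word_one, h.word_ten, fun z => by rw [h.current, hdeg],
    fun z => by rw [h.degree, hdeg], fun z => by rw [h.nbr, hl.reverse.dartSum_eq]; rfl,
    fun z _ => ?_, ?_, by rw [h.acc]; ring, h.zero⟩
  · rw [h.size, zero_add, hT.sum_branchSize, Fintype.card_fin]
  · rw [h.prod, Finset.prod_range]
    simp only [hdeg]

/-- Start again with the vertex `0`. -/
def resetBlock : List Instr := [.wordSub 2 10 10]

/-- Compute the numerator and the denominator of the conditional expectation. -/
def finishBlock : List Instr :=
  [.numOfWord 5 0, .numOfWord 6 1, .numMul 7 5 5, .numSub 8 7 6, .numMul 8 8 2,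
    .wordAdd 5 1 1, .wordAdd 5 5 1, .numOfWord 9 5, .numDiv 8 8 9, .numAdd 7 7 5, .numSub 7 7 6,
    .numSub 3 5 6, .numMul 3 3 7, .numAdd 3 3 4, .numMul 3 3 1, .numDiv 3 3 9, .numSub 8 8 3,
    .numMul 5 5 1, .numSub 5 2 5]

/-- The program for the conditional expectation of the sum of edge lengths, given that there is a
crossing. -/
def crossingProg : Prog :=
  .seq readProg (.seq (block resetBlock) (.seq peelProg (.seq (block finishBlock)
    (.ite (.numLt 10 5) (.instr (.numDiv 0 8 5)) .skip))))

open scoped Classical in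
theorem finishBlock_to {T : SimpleGraph (Fin n)} (hW : 3 < W) {σ : State} (h : Peeling T ⊥ σ)
    (hf : σ.num 2 = (n ! : ℚ)) :
    BlockTo S W (fun σ' => σ'.num 10 = 0 ∧
      σ'.num 5 = (n ! : ℚ) - n * ∏ x, ((T.degree x)! : ℚ) ∧
      σ'.num 8 = (n ! : ℚ) * ((n : ℚ) ^ 2 - 1) / 3 - (∏ x, ((T.degree x)! : ℚ)) *
        (2 * ((n : ℚ) - 1) * ((n : ℚ) ^ 2 + n - 1) +
          ∑ u, ∑ v ∈ T.neighborFinset u, (planarWeight T u v : ℚ)) / 6) finishBlock σ := by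
  have hacc := h.acc
  simp only [SimpleGraph.neighborFinset_eq_filter, SimpleGraph.bot_adj, Finset.filter_false,
    Finset.sum_empty, Finset.sum_const_zero, add_zero] at hacc
  have h2 : 2 < W := by omega
  simp [finishBlock, BlockTo, Instr.Legal, Instr.apply, h.word_zero, h.word_one, h.prod, h.zero,
    hf, h2, hW]
  simp only [SimpleGraph.neighborFinset_eq_filter]
  rw [← hacc]
  ring

/-- Reading takes at most `22 n` steps, peeling at most `20 (2 n - 2) + 12 n` up to a constant, and
the rest is constant; the factor `200` is generous. -/
theorem crossingProg_spec {T : SimpleGraph (Fin n)} (hT : T.IsTree) {l : List (Fin n × Fin n)}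
    (hl : IsEdgeList T l) :
    Runs (200 * n) ((n + 1) ^ 200) crossingProg (200 * n) (input l) fun _ σ =>
      (∃ π : Arrangement (Fin n), 1 ≤ crossings T π) →
        (σ.num 0 : ℝ) = expSumLengthsCrossing T := by
  classical
  have hlen := hl.length_eq hT
  have hS : n ≤ 200 * n := by omega
  have hW : ∀ m ≤ 2 * n * n + 2 * n + 3, m < (n + 1) ^ 200 := by
    intro m hm
    -- The fourth power of `n + 1` already suffices, since `n ≥ 1`.
    refine hm.trans_lt (lt_of_lt_of_le ?_ (Nat.pow_le_pow_right (by omega) (by omega : 4 ≤ 200)))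
    have h1 : 1 ≤ n := by omega
    nlinarith [Nat.mul_le_mul h1 h1, Nat.zero_le (n ^ 4), Nat.zero_le (n ^ 3)]
  have hsum : ∑ z, T.degree z + 2 = 2 * n := by
    have h1 := hT.card_edgeFinset
    have h2 := T.sum_degrees_eq_twice_card_edges
    rw [Fintype.card_fin] at h1
    omega
  refine Runs.seq (readProg_runs hlen hS hW (by omega)) ?_
  rintro k₁ σ₁ ⟨hk₁, hr⟩
  have hreset : BlockTo (200 * n) ((n + 1) ^ 200)
      (fun σ => Peeling T T σ ∧ σ.word 2 = 0 ∧ σ.num 2 = 1) resetBlock σ₁ := by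
    have h := hr.peeling hT hl
    simp [resetBlock, BlockTo, Instr.Legal, Instr.apply, hr.fact]
    exact ⟨h.le, h.word_zero, h.word_one, h.word_ten, h.current, h.degree, h.nbr, h.size, h.prod,
      h.acc, h.zero⟩
  have hlen1 : resetBlock.length = 1 := rfl
  refine Runs.seq (hreset.runs (by omega)) ?_
  rintro k₂ σ₂ ⟨hk₂, hp, h2, hf⟩
  refine Runs.seq (peelProg_runs hT hS hW hp h2 hf (C := 30) (by omega)) ?_
  rintro k₃ σ₃ ⟨hp, hf, hk₃⟩
  have hlen2 : finishBlock.length = 19 := rfl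
  refine Runs.seq ((finishBlock_to (hW 3 (by omega)) hp hf).runs (by omega)) ?_
  rintro k₄ σ₄ ⟨hk₄, h10, h5, h8⟩
  -- A crossing makes the denominator positive, by `numPlanar_lt`. The test guards against division
  -- by zero when every arrangement is planar.
  by_cases hlt : σ₄.num 10 < σ₄.num 5
  · refine ⟨2, _, 0, .ite_true hlt (.instr _ _ ?_), by omega, fun _ => ?_⟩
    · exact fun h0 => by
        rw [h10, h0] at hlt
        exact lt_irrefl _ hlt
    · rw [expSumLengthsCrossing_eq_div hT]
      simp only [Instr.apply, Function.update_self, h5, h8, Fintype.card_fin]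
  · refine ⟨1, σ₄, 0, .ite_false hlt (.skip _), by omega, fun hex => absurd ?_ hlt⟩
    have h := numPlanar_lt hex
    rw [numPlanar_eq hT, Fintype.card_fin] at h
    rw [h10, h5, sub_pos]
    exact_mod_cast h

end RAM

end

theorem mainTheorem6 :
    -- the formula, for every free tree
    (∀ (V : Type*) [Fintype V] (T : SimpleGraph V), T.IsTree →
      probNoCrossing T = (numPlanar T : ℝ) / ((Fintype.card V)! : ℝ) ∧
      probCrossing T =
        (((Fintype.card V)! : ℝ) - (numPlanar T : ℝ)) / ((Fintype.card V)! : ℝ) ∧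
      ((∃ π : Arrangement V, 1 ≤ crossings T π) →
        0 < probCrossing T ∧
        expSumLengthsCrossing T =
          (expSumLengths T - expSumLengthsPlanar T * probNoCrossing T) / probCrossing T)) ∧
    -- one program computes the conditional expectation in linear time and linear space,
    -- on words of logarithmic length
    (∃ (p : RAM.Prog) (K : ℕ), ∀ (n : ℕ) (T : SimpleGraph (Fin n)), T.IsTree →
      ∀ l : List (Fin n × Fin n), RAM.IsEdgeList T l →
        ∃ (t : ℕ) (σ : RAM.State),
          RAM.Exec (K * n) ((n + 1) ^ K) p (RAM.input l) t σ ∧ t ≤ K * n ∧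
          ((∃ π : Arrangement (Fin n), 1 ≤ crossings T π) →
            (σ.num 0 : ℝ) = expSumLengthsCrossing T)) := by
  refine ⟨fun V _ T _ => ⟨probNoCrossing_eq T, probCrossing_eq T, expSumLengthsCrossing_formula⟩,
    RAM.crossingProg, 200, fun n T hT l hl => ?_⟩
  obtain ⟨t, σ, k, he, ht, hσ⟩ := RAM.crossingProg_spec hT hl
  exact ⟨t, σ, he, by omega, hσ⟩
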